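/- Let $\alpha,\beta\in\mathbb R$, let $\tau\in\mathbb R[x]$ with $\tau(\pm1)\neq 0$, and put $\eta=\frac{\alpha+1}{x-1}+\frac{\beta+1}{x+1}$ and $$T_{\mathrm{ng}}(\tau;\alpha,\beta)=(x^2-1)\Bigl(D^2-2\tfrac{\tau'}{\tau}D+\tfrac{\tau''}{\tau}+\eta\bigl(D-\tfrac{\tau'}{\tau}\bigr)\Bigr)+2x\tfrac{\tau'}{\tau},\qquad T_{\mathrm{rg}}(\tau;\alpha,\beta)=\tau^{-1}\circ T_{\mathrm{ng}}(\tau;\alpha,\beta)\circ\tau .$$ Assume that $T=T_{\mathrm{rg}}(\tau;\alpha,\beta)$ is an exceptional Jacobi operator in the rational gauge, that is, for all but finitely many $n\in\mathbb N_0$ there are a real polynomial $P$ of degree $n$ and a constant $\kappa\in\mathbb R$ with $T_{\mathrm{ng}}(\tau;\alpha,\beta)P=\kappa P$. A quasi-rational function on a nonempty open interval $J\subseteq\mathbb R$ is a function $\phi$, meromorphic on $J$ and not identically zero, whose log-derivative $w=\phi'/\phi$ is a rational function, $w\in\mathbb R(x)$. Its type is $1$ if $w$ is regular at both $1$ and $-1$,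 $2$ if $w$ has poles at both, $3$ if $w$ has a pole at $1$ but not at $-1$, and $4$ if $w$ has a pole at $-1$ but not at $1$. Its degree $\deg\phi$ is the coefficient of $1/x$ in the expansion of $w$ at infinity. Put $$\mu_1=1,\quad \mu_2=(1-x)^{-\alpha}(1+x)^{-\beta},\quad \mu_3=(1-x)^{-\alpha},\quad \mu_4=(1+x)^{-\beta},$$ where a non-integer power of a negative number $t$ is understood as the branch $|t|^{a}$ (so on $(-1,1)$ these are ordinary powers). Let $\phi$ be a quasi-rational function on $J$ of type $\iota\in\{1,2,3,4\}$ with $T\phi=\lambda\phi$ for some $\lambda\in\mathbb R$. Then there is a polynomial $\hat\tau\in\mathbb R[x]$ with $\hat\tau(\pm1)\ne0$ such that $$\phi(x)=\mu_\iota(x)\,\frac{\hat\tau(x)}{\tau(x)}$$ on $J$ (away from finitely many points), and moreover $$\lambda=\deg\phi\,(\deg\phi+\alpha+\beta+1),\qquad \deg\phi=\deg\mu_\iota+\deg\hat\tau-\deg\tau,$$ where $\deg\mu_1=0$, $\deg\mu_2=-\alpha-\beta$, $\deg\mu_3=-\alpha$, $\deg\mu_4=-\beta$. -/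

import Mathlib

open Polynomial

noncomputable section

namespace XJacobi

/-! ### Rational functions -/

/-- A real polynomial, seen as an element of the field `ℝ(x)`. -/
abbrev ofPoly : ℝ[X] →+* RatFunc ℝ := algebraMap ℝ[X] (RatFunc ℝ)

/-- The value of a rational function at a real point (used only away from its poles). -/
abbrev valueAt (f : RatFunc ℝ) (x : ℝ) : ℝ := RatFunc.eval (RingHom.id ℝ) x f

/-- The derivative `d/dx` on `ℝ(x)`. -/
def D (f : RatFunc ℝ) : RatFunc ℝ :=
  ofPoly (derivative f.num * f.denom - f.num * derivative f.denom) / ofPoly f.denom ^ 2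

theorem ofPoly_ne_zero {P : ℝ[X]} (hP : P ≠ 0) : ofPoly P ≠ 0 :=
  RatFunc.algebraMap_ne_zero hP

theorem quotient_rule_aux {A B P Q : ℝ[X]} (h : A * Q = P * B) :
    (derivative A * B - A * derivative B) * Q ^ 2
      = (derivative P * Q - P * derivative Q) * B ^ 2 := by
  have h3 : derivative A * Q + A * derivative Q = derivative P * B + P * derivative B := by
    rw [← derivative_mul, ← derivative_mul, h]
  linear_combination (B * Q) * h3 - (derivative B * Q + B * derivative Q) * h

/-- The quotient rule, for an arbitrary representation as a fraction. -/
theorem D_div (P Q : ℝ[X]) (hQ : Q ≠ 0) :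
    D (ofPoly P / ofPoly Q)
      = ofPoly (derivative P * Q - P * derivative Q) / ofPoly Q ^ 2 := by
  obtain ⟨f, hf⟩ : ∃ f, f = ofPoly P / ofPoly Q := ⟨_, rfl⟩
  rw [← hf]
  have hd : ofPoly f.denom ≠ 0 := ofPoly_ne_zero f.denom_ne_zero
  have h1 : ofPoly f.num / ofPoly f.denom = ofPoly P / ofPoly Q :=
    (RatFunc.num_div_denom f).trans hf
  rw [div_eq_div_iff hd (ofPoly_ne_zero hQ), ← map_mul, ← map_mul] at h1
  have h2 := quotient_rule_aux (RatFunc.algebraMap_injective ℝ h1)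
  unfold D
  rw [div_eq_div_iff (pow_ne_zero 2 hd) (pow_ne_zero 2 (ofPoly_ne_zero hQ)),
    ← map_pow, ← map_pow, ← map_mul, ← map_mul, h2]

theorem D_mul (f g : RatFunc ℝ) : D (f * g) = D f * g + f * D g := by
  obtain ⟨P, Q, hQ, rfl⟩ : ∃ P Q : ℝ[X], Q ≠ 0 ∧ f = ofPoly P / ofPoly Q :=
    ⟨_, _, f.denom_ne_zero, (RatFunc.num_div_denom f).symm⟩
  obtain ⟨A, B, hB, rfl⟩ : ∃ A B : ℝ[X], B ≠ 0 ∧ g = ofPoly A / ofPoly B :=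
    ⟨_, _, g.denom_ne_zero, (RatFunc.num_div_denom g).symm⟩
  have e1 := ofPoly_ne_zero hQ
  have e2 := ofPoly_ne_zero hB
  rw [div_mul_div_comm, ← map_mul, ← map_mul, D_div _ _ (mul_ne_zero hQ hB), D_div _ _ hQ,
    D_div _ _ hB]
  simp only [derivative_mul, map_mul, map_sub, map_add]
  field_simp
  ring

theorem D_add (f g : RatFunc ℝ) : D (f + g) = D f + D g := by
  obtain ⟨P, Q, hQ, rfl⟩ : ∃ P Q : ℝ[X], Q ≠ 0 ∧ f = ofPoly P / ofPoly Q :=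
    ⟨_, _, f.denom_ne_zero, (RatFunc.num_div_denom f).symm⟩
  obtain ⟨A, B, hB, rfl⟩ : ∃ A B : ℝ[X], B ≠ 0 ∧ g = ofPoly A / ofPoly B :=
    ⟨_, _, g.denom_ne_zero, (RatFunc.num_div_denom g).symm⟩
  have e1 := ofPoly_ne_zero hQ
  have e2 := ofPoly_ne_zero hB
  rw [div_add_div _ _ e1 e2, ← map_mul, ← map_mul, ← map_mul, ← map_add,
    D_div _ _ (mul_ne_zero hQ hB), D_div _ _ hQ, D_div _ _ hB]
  simp only [derivative_mul, map_mul, map_sub, map_add]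
  field_simp
  ring

/-! ### Second-order operators with rational coefficients -/

/-- The operator `p D² + q D + r` with `p, q, r ∈ ℝ(x)`. -/
@[ext]
structure DiffOp where
  p : RatFunc ℝ
  q : RatFunc ℝ
  r : RatFunc ℝ

/-- The action of an operator on rational functions. -/
def DiffOp.app (T : DiffOp) (y : RatFunc ℝ) : RatFunc ℝ :=
  T.p * D (D y) + T.q * D y + T.r * y

/-- The action of an operator on real functions, at the point `x`. -/
def DiffOp.appFun (T : DiffOp) (φ : ℝ → ℝ) (x : ℝ) : ℝ :=
  valueAt T.p x * deriv (deriv φ) x + valueAt T.q x * deriv φ x + valueAt T.r x * φ x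

/-- The gauge transform `M(f)⁻¹ ∘ T ∘ M(f)`, where `M(f)` is multiplication by `f`;
see `DiffOp.app_gauge`. -/
def DiffOp.gauge (T : DiffOp) (f : RatFunc ℝ) : DiffOp where
  p := T.p
  q := T.q + 2 * T.p * (D f / f)
  r := T.r + T.q * (D f / f) + T.p * (D (D f) / f)

theorem DiffOp.app_gauge (T : DiffOp) {f : RatFunc ℝ} (hf : f ≠ 0) (y : RatFunc ℝ) :
    (T.gauge f).app y = f⁻¹ * T.app (f * y) := by
  simp only [DiffOp.app, DiffOp.gauge, D_mul, D_add]
  field_simp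
  ring

/-- The degree set of `T`: the degrees of its eigenpolynomials, i.e. of the nonzero polynomials
`P` with `T P = κ P` for some constant `κ`. -/
def DiffOp.degreeSet (T : DiffOp) : Set ℕ :=
  {n | ∃ P : ℝ[X], P ≠ 0 ∧ P.natDegree = n ∧
    ∃ κ : ℝ, T.app (ofPoly P) = RatFunc.C κ * ofPoly P}

/-- `T` is an exceptional Jacobi operator: its leading coefficient is `x² - 1` and it has
eigenpolynomials of all but finitely many degrees. -/
def DiffOp.IsExceptionalJacobi (T : DiffOp) : Prop :=
  T.p = RatFunc.X ^ 2 - 1 ∧ (T.degreeSet)ᶜ.Finite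

/-- `η(x; α, β) = (α + 1)/(x - 1) + (β + 1)/(x + 1)`. -/
def eta (α β : ℝ) : RatFunc ℝ :=
  RatFunc.C (α + 1) / (RatFunc.X - 1) + RatFunc.C (β + 1) / (RatFunc.X + 1)

/-- The natural gauge operator `T_ng(τ; α, β)`:
`(x²-1) (D² - 2 (τ'/τ) D + τ''/τ + η (D - τ'/τ)) + 2 x τ'/τ`. -/
def Tng (τ : ℝ[X]) (α β : ℝ) : DiffOp where
  p := RatFunc.X ^ 2 - 1
  q := (RatFunc.X ^ 2 - 1) * (eta α β - 2 * (D (ofPoly τ) / ofPoly τ))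
  r := (RatFunc.X ^ 2 - 1) *
      (D (D (ofPoly τ)) / ofPoly τ - eta α β * (D (ofPoly τ) / ofPoly τ))
    + 2 * RatFunc.X * (D (ofPoly τ) / ofPoly τ)

/-- The rational gauge operator `T_rg(τ; α, β) = M(τ)⁻¹ ∘ T_ng(τ; α, β) ∘ M(τ)`. -/
def Trg (τ : ℝ[X]) (α β : ℝ) : DiffOp := (Tng τ α β).gauge (ofPoly τ)

/-- `T_rg(τ; α, β) = (x²-1) (D² + η D) + 2 (x²-1) u' + 2 x u` with `u = τ'/τ`. -/
theorem Trg_eq {τ : ℝ[X]} (hτ : τ ≠ 0) (α β : ℝ) :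
    Trg τ α β = ⟨RatFunc.X ^ 2 - 1, (RatFunc.X ^ 2 - 1) * eta α β,
      2 * (RatFunc.X ^ 2 - 1) * D (D (ofPoly τ) / ofPoly τ)
        + 2 * RatFunc.X * (D (ofPoly τ) / ofPoly τ)⟩ := by
  have h := ofPoly_ne_zero hτ
  have hu : D (D (ofPoly τ) / ofPoly τ)
      = D (D (ofPoly τ)) / ofPoly τ - (D (ofPoly τ) / ofPoly τ) ^ 2 := by
    have h1 : D (D (ofPoly τ) / ofPoly τ * ofPoly τ) = D (D (ofPoly τ)) := by
      rw [div_mul_cancel₀ _ h]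
    rw [D_mul] at h1
    field_simp
    field_simp at h1
    linear_combination h1
  rw [hu]
  ext <;> simp only [Trg, DiffOp.gauge, Tng]
  · ring
  · ring

/-! ### Quasi-rational functions -/

/-- `φ` is a quasi-rational function on `J` with log-derivative `w ∈ ℝ(x)`: it is meromorphic on
`J`, and `φ ≠ 0`, `φ' = w φ` at all but finitely many points of `J`. -/
def IsQuasiRationalOn (φ : ℝ → ℝ) (J : Set ℝ) (w : RatFunc ℝ) : Prop :=
  MeromorphicOn φ J ∧
    ∃ S : Set ℝ, S.Finite ∧ ∀ x ∈ J \ S, φ x ≠ 0 ∧ HasDerivAt φ (valueAt w x * φ x) x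

/-- `φ` is a quasi-rational eigenfunction of `T` on `J`, with eigenvalue `κ` and
log-derivative `w`. -/
def DiffOp.IsQREigenfunctionOn (T : DiffOp) (κ : ℝ) (φ : ℝ → ℝ) (J : Set ℝ)
    (w : RatFunc ℝ) : Prop :=
  IsQuasiRationalOn φ J w ∧
    ∃ S : Set ℝ, S.Finite ∧ ∀ x ∈ J \ S, T.appFun φ x = κ * φ x

/-- The degree of a quasi-rational function with log-derivative `w`: the residue of `w` at
infinity, i.e. the coefficient of `1/x` in the expansion of `w` in descending powers of `x`
(with the sign for which a rational function has degree `deg num - deg denom`).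
If `w = A + R/Q` with `Q` monic and `deg R < deg Q`, this is the coefficient of `x^(deg Q - 1)`
in `R`. -/
def qrDegree (w : RatFunc ℝ) : ℝ := (w.num %ₘ w.denom).coeff (w.denom.natDegree - 1)

/-- The four asymptotic types. -/
inductive AType
  | type1 | type2 | type3 | type4

/-- The asymptotic type of a quasi-rational function with log-derivative `w`:
type 1 if `w` is regular at `1` and `-1`, type 2 if it has poles at both,
type 3 if it has a pole at `1` only, type 4 if it has a pole at `-1` only. -/
def asympType (w : RatFunc ℝ) : AType :=
  if w.denom.eval 1 = 0 then
    if w.denom.eval (-1) = 0 then AType.type2 else AType.type3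
  else
    if w.denom.eval (-1) = 0 then AType.type4 else AType.type1

/-- A real branch of `t ↦ t ^ a` on each of the half-lines `t > 0`, `t < 0`: it is the power
`t ^ a` itself for `t > 0` or `a` an integer, and `|t| ^ a` for `t < 0` and `a` not an integer. -/
def branchPow (t a : ℝ) : ℝ :=
  open Classical in if a ∈ Set.range (Int.cast : ℤ → ℝ) then t ^ a else |t| ^ a

/-- The gauge factors `μ_ι(x; α, β)`. -/
def mu (α β : ℝ) : AType → ℝ → ℝ
  | .type1, _ => 1
  | .type2, x => branchPow (1 - x) (-α) * branchPow (1 + x) (-β)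
  | .type3, x => branchPow (1 - x) (-α)
  | .type4, x => branchPow (1 + x) (-β)

/-- The values `0, -α-β, -α, -β` of `deg μ_ι`. -/
def muDegree (α β : ℝ) : AType → ℝ
  | .type1 => 0
  | .type2 => -α - β
  | .type3 => -α
  | .type4 => -β

end XJacobi

end

noncomputable section

namespace XJacobi

/-! ### The derivation `D` -/

/-! Put u = τ'/τ. Since φ' = wφ, the eigenvalue equation becomes a Riccati equation in ℝ(x):
(x²-1)(w' + w²) + (x²-1)ηw + 2(x²-1)u' + 2xu = κ (`Trg_eq`, `riccati_of_eigenfunction`). It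
determines the poles and residues of w place by place. Real primes may be quadratic, so poles are
measured by valuations. With t = p at a prime p and t = x at infinity, t·d/dx does not increase the
valuation, so the quadratic term forces W = tw to be integral (`regular_of_riccati`). Reducing at
the place then leaves a quadratic equation for the residue.

At infinity the residue d of xw satisfies κ = d(d+α+β+1) (`IsRiccatiSolution.infty`). At 1 and -1,
where τ does not vanish, the residue is 0 or the exponent of μ, and which one occurs is the type
(`IsRiccatiSolution.endpoint_residue`). At any other prime, of multiplicity m in τ, the residue c
satisfies c(c-1) = 2m. Exceptionality enters only here: a single eigenpolynomial P gives the
solution P'/P - τ'/τ, whose residues are integers, so both roots c and 1-c are integers, and both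
are at least -m. Thus w + u has natural residues (`exists_nat_residue`).

Consequently w + u - μ'/μ = A + σ'/σ with polynomials A and σ, and boundedness of xw at infinity
kills A (`exists_form`). Now φ and μσ/τ have the same log-derivative. Their quotient must be
constant across singular points inside J as well: if μ has a singular factor at a point of J,
meromorphy of φ makes its exponent an integer (`exponent_mem_range_intCast`), and the identity
theorem for meromorphic functions gives one constant on all of J
(`IsQuasiRationalOn.exists_eq_mul`). -/

theorem D_ofPoly (P : ℝ[X]) : D (ofPoly P) = ofPoly (derivative P) := by
  simpa using D_div P 1 one_ne_zero

theorem D_C (c : ℝ) : D (RatFunc.C c) = 0 := by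
  have h := D_ofPoly (C c)
  rwa [derivative_C, map_zero, RatFunc.algebraMap_C] at h

theorem D_X : D RatFunc.X = 1 := by
  have h := D_ofPoly X
  rwa [derivative_X, map_one, RatFunc.algebraMap_X] at h

theorem D_neg (f : RatFunc ℝ) : D (-f) = -D f := by
  have h := D_mul (RatFunc.C (-1)) f
  rw [D_C] at h
  simpa using h

theorem D_sub (f g : RatFunc ℝ) : D (f - g) = D f - D g := by
  rw [sub_eq_add_neg, D_add, D_neg, sub_eq_add_neg]

/-! ### Logarithmic derivations at a place of `ℝ(x)` -/

/-- `t D` preserves the filtration of `ℝ(x)` by the valuation `v`, and acts as zero on the residue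
field. -/
structure IsLogDerivation (v : Valuation (RatFunc ℝ) (WithZero (Multiplicative ℤ)))
    (t : RatFunc ℝ) : Prop where
  le : ∀ f, v (t * D f) ≤ v f
  lt : ∀ f, v f ≤ 1 → v (t * D f) < 1

section Valuation

variable {v : Valuation (RatFunc ℝ) (WithZero (Multiplicative ℤ))} {t : RatFunc ℝ}

/-- By the quotient rule t(P/Q)' = tP'/Q - (P/Q)(tQ'/Q), and the hypothesis bounds both terms by
v(P/Q). -/
theorem map_mul_D_le_of_polynomial (h : ∀ P : ℝ[X], v (t * ofPoly (derivative P)) ≤ v (ofPoly P))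
    (f : RatFunc ℝ) : v (t * D f) ≤ v f := by
  obtain ⟨P, Q, hQ, rfl⟩ : ∃ P Q : ℝ[X], Q ≠ 0 ∧ f = ofPoly P / ofPoly Q :=
    ⟨_, _, f.denom_ne_zero, (RatFunc.num_div_denom f).symm⟩
  have e := ofPoly_ne_zero hQ
  have hv : v (ofPoly Q) ≠ 0 := (Valuation.ne_zero_iff v).2 e
  have key : t * D (ofPoly P / ofPoly Q) = t * ofPoly (derivative P) / ofPoly Q
      - ofPoly P / ofPoly Q * (t * ofPoly (derivative Q) / ofPoly Q) := by
    rw [D_div _ _ hQ, map_sub, map_mul, map_mul]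
    field_simp
  rw [key]
  refine Valuation.map_sub_le v ?_ ?_
  · rw [map_div₀, map_div₀]
    exact div_le_div_of_nonneg_right (h P) (zero_le (a := v (ofPoly Q)))
  · rw [map_mul, map_div₀ v (t * _)]
    exact mul_le_of_le_one_right' (div_le_one_of_le₀ (h Q) zero_le)

/-- If v W > 1, every term except aW² has valuation at most v W, while aW² has valuation (v W)² > v
W, so the sum cannot vanish. -/
theorem regular_of_riccati (ht : ∀ f, v (t * D f) ≤ v f) {W a b c e : RatFunc ℝ} (ha : v a = 1)
    (hb : v b ≤ 1) (hc : v c ≤ 1) (he : v e ≤ 1)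
    (h : a * W ^ 2 + b * (t * D W) + c * W + e = 0) : v W ≤ 1 := by
  by_contra! hW
  have h0 : a * W ^ 2 = -(b * (t * D W) + c * W + e) := by linear_combination h
  have h1 : v (a * W ^ 2) ≤ v W := by
    rw [h0, Valuation.map_neg]
    refine Valuation.map_add_le v (Valuation.map_add_le v ?_ ?_) (he.trans hW.le)
    · rw [map_mul]
      exact (mul_le_of_le_one_left' hb).trans (ht W)
    · rw [map_mul]
      exact mul_le_of_le_one_left' hc
  rw [map_mul, ha, one_mul, map_pow, sq] at h1
  have h2 : v W * 1 < v W * v W := by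
    gcongr
    exact zero_lt_one.trans hW
  rw [mul_one] at h2
  exact absurd h1 (not_le.2 h2)

theorem lt_one_or_lt_one_of_mul {f g : RatFunc ℝ} (h : v (f * g) < 1) : v f < 1 ∨ v g < 1 := by
  by_contra! hc
  rw [map_mul] at h
  exact absurd h (not_lt.2 (one_le_mul hc.1 hc.2))

theorem map_mul_lt_one {f g : RatFunc ℝ} (hf : v f ≤ 1) (hg : v g < 1) : v (f * g) < 1 := by
  rw [map_mul]
  exact (mul_le_of_le_one_left' hf).trans_lt hg

theorem map_mul_le_one {f g : RatFunc ℝ} (hf : v f ≤ 1) (hg : v g ≤ 1) : v (f * g) ≤ 1 := by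
  rw [map_mul]
  exact mul_le_one' hf hg

theorem lt_one_of_unit_mul {f g : RatFunc ℝ} (hf : v f = 1) (h : v (f * g) < 1) : v g < 1 := by
  rwa [map_mul, hf, one_mul] at h

end Valuation

/-! ### The finite places -/

/-- The place of `ℝ(x)` attached to an irreducible polynomial. -/
def placeOf {p : ℝ[X]} (hp : Irreducible p) : IsDedekindDomain.HeightOneSpectrum ℝ[X] where
  asIdeal := Ideal.span {p}
  isPrime := (Ideal.span_singleton_prime hp.ne_zero).2 hp.prime
  ne_bot := by simpa using hp.ne_zero

/-- The `p`-adic valuation of `ℝ(x)`. -/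
abbrev valuationOf {p : ℝ[X]} (hp : Irreducible p) :
    Valuation (RatFunc ℝ) (WithZero (Multiplicative ℤ)) :=
  (placeOf hp).valuation (RatFunc ℝ)

section FinitePlace

variable {p : ℝ[X]} (hp : Irreducible p)

theorem valuationOf_poly_le_one (P : ℝ[X]) : valuationOf hp (ofPoly P) ≤ 1 :=
  (placeOf hp).valuation_le_one P

theorem valuationOf_poly_lt_one_iff (P : ℝ[X]) : valuationOf hp (ofPoly P) < 1 ↔ p ∣ P := by
  rw [IsDedekindDomain.HeightOneSpectrum.valuation_lt_one_iff_dvd]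
  simp [placeOf, Ideal.dvd_span_singleton, Ideal.mem_span_singleton]

theorem valuationOf_poly_eq_one {P : ℝ[X]} (h : ¬ p ∣ P) : valuationOf hp (ofPoly P) = 1 :=
  le_antisymm (valuationOf_poly_le_one hp P)
    (not_lt.1 (mt (valuationOf_poly_lt_one_iff hp P).1 h))

theorem valuationOf_self : valuationOf hp (ofPoly p) = WithZero.exp (-1 : ℤ) := by
  rw [valuationOf, IsDedekindDomain.HeightOneSpectrum.valuation_of_algebraMap]
  exact (placeOf hp).intValuation_singleton hp.ne_zero rfl

/-- The value group is discrete: a value below 1 is at most exp(-1), the value of p. -/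
theorem valuationOf_div_self_le_one {f : RatFunc ℝ} (hf : valuationOf hp f < 1) :
    valuationOf hp (f / ofPoly p) ≤ 1 := by
  rw [map_div₀, valuationOf_self]
  refine div_le_one_of_le₀ ?_ zero_le
  rcases eq_or_ne (valuationOf hp f) 0 with h0 | h0
  · rw [h0]; exact zero_le
  · rw [← WithZero.exp_log h0, ← WithZero.exp_zero, WithZero.exp_lt_exp] at hf
    rw [← WithZero.exp_log h0, WithZero.exp_le_exp]
    omega

theorem not_dvd_denom_iff {f : RatFunc ℝ} : ¬ p ∣ f.denom ↔ valuationOf hp f ≤ 1 := by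
  have e : valuationOf hp (ofPoly f.denom) ≠ 0 :=
    (Valuation.ne_zero_iff _).2 (ofPoly_ne_zero f.denom_ne_zero)
  have hf : valuationOf hp f = valuationOf hp (ofPoly f.num) / valuationOf hp (ofPoly f.denom) := by
    rw [← map_div₀, RatFunc.num_div_denom]
  rw [hf]
  constructor
  · intro h
    rw [valuationOf_poly_eq_one hp h, div_one]
    exact valuationOf_poly_le_one hp _
  · intro h hd
    have hn : ¬ p ∣ f.num := fun hn =>
      hp.not_isUnit ((RatFunc.isCoprime_num_denom f).isUnit_of_dvd' hn hd)
    rw [valuationOf_poly_eq_one hp hn, div_le_iff₀ (zero_lt_iff.2 e), one_mul] at h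
    exact absurd ((valuationOf_poly_lt_one_iff hp _).2 hd) (not_lt.2 h)

theorem isLogDerivation_valuationOf : IsLogDerivation (valuationOf hp) (ofPoly p) where
  le := by
    refine map_mul_D_le_of_polynomial fun P => ?_
    rcases eq_or_ne P 0 with rfl | hP
    · simp
    obtain ⟨k, P₁, h₁, rfl⟩ := WfDvdMonoid.max_power_factor hP hp
    -- Differentiation costs at most one factor p, and the multiplier p restores it.
    have key : ofPoly p * ofPoly (derivative (p ^ k * P₁))
        = ofPoly p ^ k * ofPoly (C (k : ℝ) * derivative p * P₁ + p * derivative P₁) := by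
      rw [← map_mul, ← map_pow, ← map_mul, derivative_mul, derivative_pow]
      congr 1
      rcases k with _ | k
      · simp
      · simp only [Nat.add_sub_cancel]; ring
    rw [key, map_mul, map_mul, map_mul, valuationOf_poly_eq_one hp h₁, mul_one, map_pow ofPoly]
    exact mul_le_of_le_one_right' (valuationOf_poly_le_one hp _)
  lt := by
    intro f hf
    have hd := (not_dvd_denom_iff hp).2 hf
    have e := ofPoly_ne_zero f.denom_ne_zero
    -- An integral f has denominator prime to p, so f' is integral and p f' vanishes modulo p.
    rw [D, map_mul, map_div₀, map_pow, valuationOf_poly_eq_one hp hd, one_pow, div_one]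
    exact (mul_le_of_le_one_right' (valuationOf_poly_le_one hp _)).trans_lt
      ((valuationOf_poly_lt_one_iff hp p).2 dvd_rfl)

/-- Irreducible polynomials are separable in characteristic zero. Residues at p are measured as
multiples of p', which therefore has to be a unit at p. -/
theorem not_dvd_derivative_of_irreducible {p : ℝ[X]} (hp : Irreducible p) : ¬ p ∣ derivative p := by
  intro h
  have h1 : IsCoprime p (derivative p) := (PerfectField.separable_of_irreducible hp)
  exact hp.not_isUnit (h1.isUnit_of_dvd' dvd_rfl h)

theorem valuationOf_C {c : ℝ} (hc : c ≠ 0) : valuationOf hp (RatFunc.C c) = 1 := by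
  rw [← RatFunc.algebraMap_C]
  refine valuationOf_poly_eq_one hp fun h => hp.not_isUnit (isUnit_of_dvd_unit h ?_)
  exact isUnit_C.2 hc.isUnit

theorem valuationOf_C_le_one (c : ℝ) : valuationOf hp (RatFunc.C c) ≤ 1 := by
  rw [← RatFunc.algebraMap_C]
  exact valuationOf_poly_le_one hp _

/-- The residue of the logarithmic derivative of a polynomial is its multiplicity. -/
theorem exists_residue_logDeriv {P : ℝ[X]} (hP : P ≠ 0) :
    ∃ k : ℕ, valuationOf hp
      (ofPoly p * (D (ofPoly P) / ofPoly P) - RatFunc.C (k : ℝ) * ofPoly (derivative p)) < 1 := by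
  obtain ⟨k, P₁, h₁, rfl⟩ := WfDvdMonoid.max_power_factor hP hp
  refine ⟨k, ?_⟩
  have hP₁ : P₁ ≠ 0 := right_ne_zero_of_mul hP
  have e := ofPoly_ne_zero hP₁
  have e' := ofPoly_ne_zero hp.ne_zero
  have key : ofPoly p * (D (ofPoly (p ^ k * P₁)) / ofPoly (p ^ k * P₁))
      - RatFunc.C (k : ℝ) * ofPoly (derivative p) = ofPoly p * D (ofPoly P₁) / ofPoly P₁ := by
    rw [D_ofPoly, D_ofPoly, derivative_mul, derivative_pow, ← RatFunc.algebraMap_C]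
    simp only [map_mul, map_add, map_pow]
    rcases k with _ | k
    · simp
      ring
    · simp only [Nat.add_sub_cancel]
      field_simp
      ring
  rw [key, map_div₀, valuationOf_poly_eq_one hp h₁, div_one]
  exact (isLogDerivation_valuationOf hp).lt _ (valuationOf_poly_le_one hp _)

end FinitePlace

/-! ### The place at infinity -/

/-- The valuation of `ℝ(x)` at infinity. -/
abbrev valuationInfty : Valuation (RatFunc ℝ) (WithZero (Multiplicative ℤ)) :=
  open Classical in RatFunc.inftyValuation ℝ

theorem valuationInfty_poly {P : ℝ[X]} (hP : P ≠ 0) :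
    valuationInfty (ofPoly P) = WithZero.exp (P.natDegree : ℤ) := by
  classical
  exact RatFunc.inftyValuation.polynomial ℝ hP

theorem valuationInfty_C {c : ℝ} (hc : c ≠ 0) : valuationInfty (RatFunc.C c) = 1 := by
  classical
  exact RatFunc.inftyValuation.C ℝ hc

theorem valuationInfty_C_le_one (c : ℝ) : valuationInfty (RatFunc.C c) ≤ 1 := by
  rcases eq_or_ne c 0 with rfl | hc
  · simp
  · exact (valuationInfty_C hc).le

theorem valuationInfty_poly_le {P Q : ℝ[X]} (h : P.natDegree ≤ Q.natDegree) (hQ : Q ≠ 0) :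
    valuationInfty (ofPoly P) ≤ valuationInfty (ofPoly Q) := by
  rcases eq_or_ne P 0 with rfl | hP
  · simp
  · rw [valuationInfty_poly hP, valuationInfty_poly hQ, WithZero.exp_le_exp]
    exact_mod_cast h

theorem valuationInfty_poly_lt {P Q : ℝ[X]} (h : P.degree < Q.degree) :
    valuationInfty (ofPoly P) < valuationInfty (ofPoly Q) := by
  have hQ : Q ≠ 0 := by rintro rfl; simp at h
  rcases eq_or_ne P 0 with rfl | hP
  · rw [map_zero, map_zero]
    exact zero_lt_iff.2 ((Valuation.ne_zero_iff _).2 (ofPoly_ne_zero hQ))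
  · rw [valuationInfty_poly hP, valuationInfty_poly hQ, WithZero.exp_lt_exp]
    exact_mod_cast (natDegree_lt_natDegree_iff hP).2 h

theorem valuationInfty_div_lt_one {P Q : ℝ[X]} (h : P.degree < Q.degree) :
    valuationInfty (ofPoly P / ofPoly Q) < 1 := by
  rw [map_div₀]
  have := valuationInfty_poly_lt h
  exact (div_lt_one₀ (zero_le.trans_lt this)).2 this

theorem valuationInfty_le_one_iff {f : RatFunc ℝ} :
    valuationInfty f ≤ 1 ↔ f.num.natDegree ≤ f.denom.natDegree := by
  rcases eq_or_ne f 0 with rfl | hf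
  · simp
  have hn := RatFunc.num_ne_zero hf
  have h : valuationInfty f = valuationInfty (ofPoly f.num) / valuationInfty (ofPoly f.denom) := by
    rw [← map_div₀, RatFunc.num_div_denom]
  rw [h, valuationInfty_poly hn, valuationInfty_poly f.denom_ne_zero, div_le_one₀ (by simp),
    WithZero.exp_le_exp]
  norm_cast

theorem valuationInfty_lt_one_iff {f : RatFunc ℝ} :
    valuationInfty f < 1 ↔ f.num.degree < f.denom.degree := by
  rcases eq_or_ne f 0 with rfl | hf
  · simp
  have hn := RatFunc.num_ne_zero hf
  have h : valuationInfty f = valuationInfty (ofPoly f.num) / valuationInfty (ofPoly f.denom) := by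
    rw [← map_div₀, RatFunc.num_div_denom]
  rw [h, valuationInfty_poly hn, valuationInfty_poly f.denom_ne_zero, div_lt_one₀ (by simp),
    WithZero.exp_lt_exp, ← natDegree_lt_natDegree_iff hn]
  norm_cast

/-- A monic denominator subtracts the leading part. -/
theorem degree_sub_C_mul_lt {P Q : ℝ[X]} (hQ : Q.Monic) (h : P.natDegree ≤ Q.natDegree) :
    (P - C (P.coeff Q.natDegree) * Q).degree < Q.degree := by
  rw [degree_eq_natDegree hQ.ne_zero, degree_lt_iff_coeff_zero]
  intro m hm
  rw [coeff_sub, coeff_C_mul]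
  rcases hm.eq_or_lt with rfl | hm
  · rw [hQ.coeff_natDegree, mul_one, sub_self]
  · rw [coeff_eq_zero_of_natDegree_lt (h.trans_lt hm), coeff_eq_zero_of_natDegree_lt hm]
    simp

theorem exists_residue_infty {f : RatFunc ℝ} (hf : valuationInfty f ≤ 1) :
    ∃ c : ℝ, valuationInfty (f - RatFunc.C c) < 1 := by
  have h := degree_sub_C_mul_lt (RatFunc.monic_denom f) (valuationInfty_le_one_iff.1 hf)
  -- The denominator is monic, so the value at infinity is this coefficient of the numerator (zero
  -- if f is strictly proper).
  refine ⟨f.num.coeff f.denom.natDegree, lt_of_eq_of_lt (congrArg _ ?_) (valuationInfty_div_lt_one h)⟩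
  have e := ofPoly_ne_zero f.denom_ne_zero
  rw [map_sub, map_mul, RatFunc.algebraMap_C, sub_div, mul_div_cancel_right₀ _ e,
    RatFunc.num_div_denom]

theorem isLogDerivation_infty : IsLogDerivation valuationInfty RatFunc.X := by
  have le : ∀ f, valuationInfty (RatFunc.X * D f) ≤ valuationInfty f := by
    refine map_mul_D_le_of_polynomial fun P => ?_
    rcases eq_or_ne P.natDegree 0 with h | h
    · obtain ⟨c, rfl⟩ := natDegree_eq_zero.1 h
      simp
    · have hP : P ≠ 0 := by rintro rfl; simp at h
      rw [← RatFunc.algebraMap_X, ← map_mul]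
      refine valuationInfty_poly_le ?_ hP
      have h1 := natDegree_derivative_le P
      have h2 := natDegree_mul_le (p := (X : ℝ[X])) (q := derivative P)
      rw [natDegree_X] at h2
      omega
  refine ⟨le, fun f hf => ?_⟩
  obtain ⟨c, hc⟩ := exists_residue_infty hf
  -- Subtracting the value at infinity changes no derivative and brings the valuation below 1.
  have h : RatFunc.X * D f = RatFunc.X * D (f - RatFunc.C c) := by
    rw [D_sub, D_C, sub_zero]
  rw [h]
  exact (le _).trans_lt hc

theorem valuationInfty_X_inv_lt_one : valuationInfty (RatFunc.X⁻¹) < 1 := by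
  classical
  have h := RatFunc.inftyValuation.X_inv ℝ
  rw [one_div] at h
  rw [valuationInfty, h, ← WithZero.exp_zero, WithZero.exp_lt_exp]
  norm_num

theorem residue_infty_unique {f : RatFunc ℝ} {c d : ℝ} (hc : valuationInfty (f - RatFunc.C c) < 1)
    (hd : valuationInfty (f - RatFunc.C d) < 1) : c = d := by
  by_contra hne
  have h := valuationInfty_C (sub_ne_zero.2 hne)
  have h2 : RatFunc.C (c - d) = (f - RatFunc.C d) - (f - RatFunc.C c) := by
    rw [map_sub]; ring
  rw [h2] at h
  exact absurd h (Valuation.map_sub_lt _ hd hc).ne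

/-- `qrDegree w` is the residue of `x w` at infinity. -/
theorem qrDegree_spec {w : RatFunc ℝ} (hw : valuationInfty (RatFunc.X * w) ≤ 1) :
    valuationInfty (RatFunc.X * w - RatFunc.C (qrDegree w)) < 1 := by
  have hw' : valuationInfty w < 1 := by
    have h : w = RatFunc.X * w * RatFunc.X⁻¹ := by
      rw [mul_right_comm, mul_inv_cancel₀ RatFunc.X_ne_zero, one_mul]
    rw [h]
    exact map_mul_lt_one hw valuationInfty_X_inv_lt_one
  have hdeg := valuationInfty_lt_one_iff.1 hw'
  have hmod : w.num %ₘ w.denom = w.num :=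
    (modByMonic_eq_self_iff (RatFunc.monic_denom w)).2 hdeg
  rcases eq_or_ne w 0 with rfl | h0
  · simp [qrDegree]
  have hlt := natDegree_lt_natDegree (RatFunc.num_ne_zero h0) hdeg
  have hX : (X * w.num).natDegree ≤ w.denom.natDegree := by
    rw [natDegree_X_mul (RatFunc.num_ne_zero h0)]
    omega
  have h := degree_sub_C_mul_lt (RatFunc.monic_denom w) hX
  have hco : (X * w.num).coeff w.denom.natDegree = qrDegree w := by
    -- A nonzero strictly proper w has a denominator of positive degree, so the subtraction of 1 in
    -- `qrDegree` is not truncated.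
    obtain ⟨n, hn⟩ : ∃ n, w.denom.natDegree = n + 1 := ⟨w.denom.natDegree - 1, by omega⟩
    rw [qrDegree, hmod, hn, coeff_X_mul, Nat.add_sub_cancel]
  rw [hco] at h
  refine lt_of_eq_of_lt (congrArg _ ?_) (valuationInfty_div_lt_one h)
  have e := ofPoly_ne_zero w.denom_ne_zero
  rw [map_sub, map_mul, map_mul, RatFunc.algebraMap_C, RatFunc.algebraMap_X, sub_div,
    mul_div_cancel_right₀ _ e, mul_div_assoc, RatFunc.num_div_denom]

theorem qrDegree_eq {w : RatFunc ℝ} {d : ℝ}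
    (h : valuationInfty (RatFunc.X * w - RatFunc.C d) < 1) : qrDegree w = d := by
  refine residue_infty_unique (qrDegree_spec ?_) h
  have h1 := Valuation.map_add_le valuationInfty h.le (valuationInfty_C_le_one d)
  rwa [sub_add_cancel] at h1

/-- The residue at infinity of the logarithmic derivative of a polynomial is its degree. -/
theorem residue_infty_logDeriv {P : ℝ[X]} (hP : P ≠ 0) :
    valuationInfty (RatFunc.X * (D (ofPoly P) / ofPoly P) - RatFunc.C (P.natDegree : ℝ)) < 1 := by
  have hlt : (X * derivative P - C (P.natDegree : ℝ) * P).degree < P.degree := by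
    rw [degree_eq_natDegree hP, degree_lt_iff_coeff_zero]
    intro m hm
    rw [coeff_sub, coeff_C_mul]
    rcases m with _ | m
    · have : P.natDegree = 0 := by omega
      simp [this]
    · rw [coeff_X_mul, coeff_derivative]
      rcases hm.eq_or_lt with h | h
      · rw [h]; push_cast; ring
      · rw [coeff_eq_zero_of_natDegree_lt h]; simp
  refine lt_of_eq_of_lt (congrArg _ ?_) (valuationInfty_div_lt_one hlt)
  have e := ofPoly_ne_zero hP
  rw [map_sub, map_mul, map_mul, RatFunc.algebraMap_C, RatFunc.algebraMap_X, sub_div,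
    mul_div_cancel_right₀ _ e, mul_div_assoc, D_ofPoly]

theorem residue_infty_simple_pole (a e : ℝ) :
    valuationInfty (RatFunc.X * (RatFunc.C a / ofPoly (X - C e)) - RatFunc.C a) < 1 := by
  have hlt : (C (a * e)).degree < (X - C e).degree := by
    rw [degree_X_sub_C]
    exact degree_C_le.trans_lt zero_lt_one
  refine lt_of_eq_of_lt (congrArg _ ?_) (valuationInfty_div_lt_one hlt)
  have e := ofPoly_ne_zero (X_sub_C_ne_zero e)
  rw [eq_div_iff e, sub_mul, ← mul_div_assoc, div_mul_cancel₀ _ e]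
  simp only [map_sub, map_mul, RatFunc.algebraMap_C, RatFunc.algebraMap_X]
  ring

theorem exists_poly_of_regular {f : RatFunc ℝ}
    (h : ∀ (p : ℝ[X]) (hp : Irreducible p), valuationOf hp f ≤ 1) : ∃ A : ℝ[X], f = ofPoly A := by
  have hu : IsUnit f.denom := by
    by_contra hu
    obtain ⟨p, hp, hd⟩ := WfDvdMonoid.exists_irreducible_factor hu f.denom_ne_zero
    exact (not_dvd_denom_iff hp).2 (h p hp) hd
  have h1 := (RatFunc.monic_denom f).eq_one_of_isUnit hu
  refine ⟨f.num, ?_⟩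
  conv_lhs => rw [← RatFunc.num_div_denom f, h1]
  simp

theorem poly_eq_zero_of_valuationInfty_lt_one {A : ℝ[X]} (h : valuationInfty (ofPoly A) < 1) :
    A = 0 := by
  by_contra hA
  rw [valuationInfty_poly hA, ← WithZero.exp_zero, WithZero.exp_lt_exp] at h
  omega

/-! ### The Riccati equation of the rational gauge operator -/

/-- The logarithmic derivative of a polynomial. -/
def logD (τ : ℝ[X]) : RatFunc ℝ := D (ofPoly τ) / ofPoly τ

theorem logD_mul {P Q : ℝ[X]} (hP : P ≠ 0) (hQ : Q ≠ 0) : logD (P * Q) = logD P + logD Q := by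
  have e1 := ofPoly_ne_zero hP
  have e2 := ofPoly_ne_zero hQ
  rw [logD, logD, logD, map_mul, D_mul]
  field_simp

theorem logD_one : logD 1 = 0 := by
  rw [logD, D_ofPoly]
  simp

theorem logD_pow {P : ℝ[X]} (hP : P ≠ 0) (n : ℕ) :
    logD (P ^ n) = RatFunc.C (n : ℝ) * logD P := by
  induction n with
  | zero => simp [logD_one]
  | succ n ih =>
    rw [pow_succ, logD_mul (pow_ne_zero n hP) hP, ih]
    push_cast
    rw [map_add, map_one]
    ring

/-- The polynomial `(x² - 1) η`. -/
def etaPoly (α β : ℝ) : ℝ[X] := C (α + 1) * (X + 1) + C (β + 1) * (X - 1)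

/-- `w` is the logarithmic derivative of a solution of `T_rg(τ; α, β) y = κ y`. -/
def IsRiccatiSolution (τ : ℝ[X]) (α β κ : ℝ) (w : RatFunc ℝ) : Prop :=
  ofPoly (X ^ 2 - 1) * (D w + w ^ 2) + ofPoly (etaPoly α β) * w
    + 2 * ofPoly (X ^ 2 - 1) * D (logD τ) + 2 * RatFunc.X * logD τ = RatFunc.C κ

theorem ofPoly_mul_eta (α β : ℝ) :
    (RatFunc.X ^ 2 - 1) * eta α β = ofPoly (etaPoly α β) := by
  have h1 : (RatFunc.X : RatFunc ℝ) - 1 ≠ 0 := by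
    have := ofPoly_ne_zero (X_sub_C_ne_zero (1 : ℝ))
    simpa using this
  have h2 : (RatFunc.X : RatFunc ℝ) + 1 ≠ 0 := by
    have := ofPoly_ne_zero (X_add_C_ne_zero (1 : ℝ))
    simpa using this
  simp only [eta, etaPoly, map_add, map_sub, map_mul, map_one, RatFunc.algebraMap_C,
    RatFunc.algebraMap_X]
  field_simp
  ring

theorem isRiccatiSolution_iff {τ : ℝ[X]} (hτ : τ ≠ 0) {α β κ : ℝ} {w : RatFunc ℝ} :
    IsRiccatiSolution τ α β κ w ↔ (Trg τ α β).p * (D w + w ^ 2) + (Trg τ α β).q * w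
      + (Trg τ α β).r = RatFunc.C κ := by
  rw [Trg_eq hτ, IsRiccatiSolution]
  simp only [ofPoly_mul_eta, logD, map_sub, map_pow, map_one, RatFunc.algebraMap_X]
  rw [← add_assoc]

/-- The gauge turns P into the eigenfunction y = P/τ of `Trg`, whose log-derivative is the
difference on the right. -/
theorem isRiccatiSolution_of_eigen {τ : ℝ[X]} (hτ : τ ≠ 0) {α β κ : ℝ} {P : ℝ[X]} (hP : P ≠ 0)
    (h : (Tng τ α β).app (ofPoly P) = RatFunc.C κ * ofPoly P) :
    IsRiccatiSolution τ α β κ (logD P - logD τ) := by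
  have e1 := ofPoly_ne_zero hP
  have e2 := ofPoly_ne_zero hτ
  have e3 : ofPoly P / ofPoly τ ≠ 0 := div_ne_zero e1 e2
  obtain ⟨y, hy⟩ : ∃ y, y = ofPoly P / ofPoly τ := ⟨_, rfl⟩
  have hmul : ofPoly P = ofPoly τ * y := by rw [hy]; field_simp
  rw [← hy] at e3
  have happ : (Trg τ α β).app y = RatFunc.C κ * y := by
    rw [Trg, DiffOp.app_gauge _ e2, ← hmul, h, hmul]
    field_simp
  have hw : logD P - logD τ = D y / y := by
    rw [logD, logD, hmul, D_mul]
    field_simp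
    ring
  have hDD : D y = D y / y * y := by field_simp
  have hDD2 : D (D y) = (D (D y / y) + (D y / y) ^ 2) * y := by
    have h1 := D_mul (D y / y) y
    rw [div_mul_cancel₀ _ e3] at h1
    rw [h1]
    field_simp
  rw [hw, isRiccatiSolution_iff hτ]
  refine mul_right_cancel₀ e3 ?_
  rw [← happ, DiffOp.app, hDD2]
  field_simp

/-! ### Local analysis at infinity -/

/-- `f` has the residue class `c` at infinity. -/
def HasValueInfty (f : RatFunc ℝ) (c : ℝ) : Prop := valuationInfty (f - RatFunc.C c) < 1

theorem HasValueInfty.le_one {f : RatFunc ℝ} {c : ℝ} (h : HasValueInfty f c) :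
    valuationInfty f ≤ 1 := by
  have h1 := Valuation.map_add_le valuationInfty (le_of_lt h) (valuationInfty_C_le_one c)
  rwa [sub_add_cancel] at h1

theorem hasValueInfty_C (c : ℝ) : HasValueInfty (RatFunc.C c) c := by
  simp [HasValueInfty]

theorem hasValueInfty_one : HasValueInfty 1 1 := by
  simpa using hasValueInfty_C 1

theorem hasValueInfty_zero_iff {f : RatFunc ℝ} : HasValueInfty f 0 ↔ valuationInfty f < 1 := by
  simp [HasValueInfty]

theorem HasValueInfty.add {f g : RatFunc ℝ} {c d : ℝ} (hf : HasValueInfty f c)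
    (hg : HasValueInfty g d) : HasValueInfty (f + g) (c + d) := by
  have h : f + g - RatFunc.C (c + d) = (f - RatFunc.C c) + (g - RatFunc.C d) := by
    rw [map_add]; ring
  rw [HasValueInfty, h]
  exact Valuation.map_add_lt _ hf hg

theorem HasValueInfty.sub {f g : RatFunc ℝ} {c d : ℝ} (hf : HasValueInfty f c)
    (hg : HasValueInfty g d) : HasValueInfty (f - g) (c - d) := by
  have h : f - g - RatFunc.C (c - d) = (f - RatFunc.C c) - (g - RatFunc.C d) := by
    rw [map_sub]; ring
  rw [HasValueInfty, h]
  exact Valuation.map_sub_lt _ hf hg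

theorem HasValueInfty.mul {f g : RatFunc ℝ} {c d : ℝ} (hf : HasValueInfty f c)
    (hg : HasValueInfty g d) : HasValueInfty (f * g) (c * d) := by
  have h : f * g - RatFunc.C (c * d)
      = f * (g - RatFunc.C d) + RatFunc.C d * (f - RatFunc.C c) := by
    rw [map_mul]; ring
  rw [HasValueInfty, h]
  exact Valuation.map_add_lt _ (map_mul_lt_one hf.le_one hg)
    (map_mul_lt_one (valuationInfty_C_le_one d) hf)

theorem HasValueInfty.unique {f : RatFunc ℝ} {c d : ℝ} (hf : HasValueInfty f c)
    (hg : HasValueInfty f d) : c = d :=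
  residue_infty_unique hf hg

/-- With W = xw and U = xu one has x²w' = xW' - W, and likewise for U. At infinity xW' and xU'
vanish and U tends to deg τ. The contributions -2 deg τ and 2 deg τ cancel, so the indicial equation
does not see τ. -/
theorem IsRiccatiSolution.infty {τ : ℝ[X]} (hτ : τ ≠ 0) {α β κ : ℝ} {w : RatFunc ℝ}
    (h : IsRiccatiSolution τ α β κ w) :
    valuationInfty (RatFunc.X * w) ≤ 1 ∧
      ∀ d, HasValueInfty (RatFunc.X * w) d → κ = d * (d + α + β + 1) := by
  have hX : (RatFunc.X : RatFunc ℝ) ≠ 0 := RatFunc.X_ne_zero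
  set W := RatFunc.X * w with hW
  set U := RatFunc.X * logD τ with hU
  have hY : HasValueInfty RatFunc.X⁻¹ 0 := hasValueInfty_zero_iff.2 valuationInfty_X_inv_lt_one
  have hUt : HasValueInfty U (τ.natDegree : ℝ) := residue_infty_logDeriv hτ
  have hδ : ∀ f, valuationInfty f ≤ 1 → HasValueInfty (RatFunc.X * D f) 0 := fun f hf =>
    hasValueInfty_zero_iff.2 (isLogDerivation_infty.lt f hf)
  have hDW : D W = w + RatFunc.X * D w := by rw [hW, D_mul, D_X, one_mul]
  have hDU : D U = logD τ + RatFunc.X * D (logD τ) := by rw [hU, D_mul, D_X, one_mul]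
  set a : RatFunc ℝ := 1 - RatFunc.X⁻¹ * RatFunc.X⁻¹ with ha
  set c : RatFunc ℝ := RatFunc.C (α + 1) * (1 + RatFunc.X⁻¹)
    + RatFunc.C (β + 1) * (1 - RatFunc.X⁻¹) - a with hc
  set e : RatFunc ℝ := RatFunc.C 2 * (a * (RatFunc.X * D U - U)) + RatFunc.C 2 * U - RatFunc.C κ
    with he
  have ha1 : HasValueInfty a (1 - 0 * 0) := hasValueInfty_one.sub (hY.mul hY)
  have hc1 := ((((hasValueInfty_C (α + 1)).mul (hasValueInfty_one.add hY)).add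
    ((hasValueInfty_C (β + 1)).mul (hasValueInfty_one.sub hY))).sub ha1)
  rw [← hc] at hc1
  have he1 := (((hasValueInfty_C 2).mul (ha1.mul ((hδ U hUt.le_one).sub hUt))).add
    ((hasValueInfty_C 2).mul hUt)).sub (hasValueInfty_C κ)
  rw [← he] at he1
  have key : a * W ^ 2 + a * (RatFunc.X * D W) + c * W + e = 0 := by
    rw [IsRiccatiSolution, etaPoly] at h
    simp only [map_add, map_sub, map_mul, map_pow, map_one, RatFunc.algebraMap_C,
      RatFunc.algebraMap_X] at h
    have h2 : RatFunc.C (2 : ℝ) = 2 := map_ofNat _ 2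
    rw [he, hDW, hDU, hc, ha, hW, hU, h2, map_add, map_add, map_one]
    field_simp
    linear_combination RatFunc.X * h
  have hav : valuationInfty a = 1 := by
    refine le_antisymm ha1.le_one (not_lt.1 fun hlt => ?_)
    have := ha1.unique (hasValueInfty_zero_iff.2 hlt)
    norm_num at this
  have hWle := regular_of_riccati isLogDerivation_infty.le hav ha1.le_one hc1.le_one he1.le_one key
  refine ⟨hWle, fun d hd => ?_⟩
  have hfin := ((((ha1.mul (hd.mul hd)).add (ha1.mul (hδ W hWle))).add (hc1.mul hd)).add he1)
  have hz : HasValueInfty 0 0 := by simp [HasValueInfty]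
  rw [← sq, key] at hfin
  have := hfin.unique hz
  linarith

/-! ### Local analysis at the finite places -/

theorem valuationOf_two_le_one {p : ℝ[X]} (hp : Irreducible p) : valuationOf hp 2 ≤ 1 := by
  have h := valuationOf_C_le_one hp 2
  rwa [show RatFunc.C (2 : ℝ) = 2 from map_ofNat _ 2] at h

theorem valuationOf_X_le_one {p : ℝ[X]} (hp : Irreducible p) :
    valuationOf hp RatFunc.X ≤ 1 := by
  rw [← RatFunc.algebraMap_X]
  exact valuationOf_poly_le_one hp _

theorem valuationOf_self_lt_one {p : ℝ[X]} (hp : Irreducible p) : valuationOf hp (ofPoly p) < 1 :=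
  (valuationOf_poly_lt_one_iff hp p).2 dvd_rfl

theorem valuationOf_mul_logD_le_one {p : ℝ[X]} (hp : Irreducible p) {τ : ℝ[X]} (hτ : τ ≠ 0) :
    valuationOf hp (ofPoly p * logD τ) ≤ 1 := by
  have hv := (Valuation.ne_zero_iff (valuationOf hp)).2 (ofPoly_ne_zero hτ)
  rw [logD, ← mul_div_assoc, map_div₀]
  exact div_le_one_of_le₀ ((isLogDerivation_valuationOf hp).le _) zero_le

theorem valuationOf_logD_le_one {p : ℝ[X]} (hp : Irreducible p) {τ : ℝ[X]} (hτ : ¬ p ∣ τ) :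
    valuationOf hp (logD τ) ≤ 1 := by
  rw [logD, D_ofPoly, map_div₀, valuationOf_poly_eq_one hp hτ, div_one]
  exact valuationOf_poly_le_one hp _

/-- Multiply the equation by p² and use p²w' = pW' - p'W for W = pw, and the same for U = pu, with U
congruent to mp'. Modulo p the terms with η, 2xu and κ disappear, and the unit x²-1 cancels. -/
theorem IsRiccatiSolution.generic {p : ℝ[X]} (hp : Irreducible p) (hp1 : ¬ p ∣ X ^ 2 - 1)
    {τ : ℝ[X]} (hτ : τ ≠ 0) {α β κ : ℝ} {w : RatFunc ℝ} (h : IsRiccatiSolution τ α β κ w) (m : ℕ)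
    (hm : valuationOf hp (ofPoly p * logD τ - RatFunc.C (m : ℝ) * ofPoly (derivative p)) < 1) :
    valuationOf hp ((ofPoly p * w) ^ 2 - ofPoly (derivative p) * (ofPoly p * w)
      - 2 * RatFunc.C (m : ℝ) * ofPoly (derivative p) ^ 2) < 1 := by
  have hle := isLogDerivation_valuationOf hp
  have hpoly := valuationOf_poly_le_one hp
  have hps := valuationOf_self_lt_one hp
  have h2 := valuationOf_two_le_one hp
  have hΔ := valuationOf_poly_eq_one hp hp1
  set W := ofPoly p * w with hW
  set U := ofPoly p * logD τ with hU
  have hU1 : valuationOf hp U ≤ 1 := valuationOf_mul_logD_le_one hp hτ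
  have hDW : D W = ofPoly (derivative p) * w + ofPoly p * D w := by rw [hW, D_mul, D_ofPoly]
  have hDU : D U = ofPoly (derivative p) * logD τ + ofPoly p * D (logD τ) := by
    rw [hU, D_mul, D_ofPoly]
  rw [IsRiccatiSolution] at h
  have key : ofPoly (X ^ 2 - 1) * W ^ 2 + ofPoly (X ^ 2 - 1) * (ofPoly p * D W)
      + ofPoly (etaPoly α β * p - (X ^ 2 - 1) * derivative p) * W
      + (2 * (ofPoly (X ^ 2 - 1) * (ofPoly p * D U - ofPoly (derivative p) * U))
        + (2 * (RatFunc.X * (ofPoly p * U)) - RatFunc.C κ * (ofPoly p * ofPoly p))) = 0 := by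
    rw [hDW, hDU, map_sub ofPoly (_ * _), map_mul, map_mul, hW, hU]
    linear_combination (ofPoly p ^ 2) * h
  have hW1 : valuationOf hp W ≤ 1 := by
    refine regular_of_riccati hle.le hΔ hΔ.le (hpoly _) ?_ key
    refine Valuation.map_add_le _ (map_mul_le_one h2 (map_mul_le_one hΔ.le
      (Valuation.map_sub_le _ (hle.lt U hU1).le (map_mul_le_one (hpoly _) hU1))))
      (Valuation.map_sub_le _ (map_mul_le_one h2 (map_mul_le_one (valuationOf_X_le_one hp)
        (map_mul_le_one hps.le hU1))) ?_)
    exact map_mul_le_one (valuationOf_C_le_one hp κ) (map_mul_le_one hps.le hps.le)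
  refine lt_one_of_unit_mul hΔ ?_
  have key2 : ofPoly (X ^ 2 - 1) * (W ^ 2 - ofPoly (derivative p) * W
      - 2 * RatFunc.C (m : ℝ) * ofPoly (derivative p) ^ 2)
      = -(ofPoly (X ^ 2 - 1) * (ofPoly p * D W) + ofPoly (etaPoly α β) * (W * ofPoly p)
        + 2 * (ofPoly (X ^ 2 - 1) * (ofPoly p * D U))
        - 2 * (ofPoly ((X ^ 2 - 1) * derivative p) *
          (U - RatFunc.C (m : ℝ) * ofPoly (derivative p)))
        + 2 * (RatFunc.X * (U * ofPoly p)) - RatFunc.C κ * (ofPoly p * ofPoly p)) := by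
    rw [map_sub ofPoly (_ * _), map_mul, map_mul] at key
    rw [map_mul ofPoly (X ^ 2 - 1) (derivative p)]
    linear_combination key
  rw [key2, Valuation.map_neg]
  refine Valuation.map_sub_lt _ (Valuation.map_add_lt _ (Valuation.map_sub_lt _
    (Valuation.map_add_lt _ (Valuation.map_add_lt _ ?_ ?_) ?_) ?_) ?_) ?_
  · exact map_mul_lt_one hΔ.le (hle.lt W hW1)
  · exact map_mul_lt_one (hpoly _) (map_mul_lt_one hW1 hps)
  · exact map_mul_lt_one h2 (map_mul_lt_one hΔ.le (hle.lt U hU1))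
  · exact map_mul_lt_one h2 (map_mul_lt_one (hpoly _) hm)
  · exact map_mul_lt_one h2 (map_mul_lt_one (valuationOf_X_le_one hp) (map_mul_lt_one hU1 hps))
  · exact map_mul_lt_one (valuationOf_C_le_one hp κ) (map_mul_lt_one hps.le hps)

/-- Here x²-1 has a simple zero and u is regular, so multiplying by x-e once suffices. The term -W
in (x-e)²w' = (x-e)W' - W lowers γ+1 to γ, leaving qW(W+γ) = 0 at e with q a unit. -/
theorem IsRiccatiSolution.endpoint {e : ℝ} (hp : Irreducible (X - C e)) {q g : ℝ[X]} {γ : ℝ}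
    {τ : ℝ[X]} (hτ : ¬ (X - C e) ∣ τ) {α β κ : ℝ} {w : RatFunc ℝ}
    (h : IsRiccatiSolution τ α β κ w) (hq : ¬ (X - C e) ∣ q) (hpq : X ^ 2 - 1 = (X - C e) * q)
    (hη : etaPoly α β = C (γ + 1) * q + g * (X - C e)) :
    valuationOf hp (ofPoly (X - C e) * w) < 1 ∨
      valuationOf hp (ofPoly (X - C e) * w + RatFunc.C γ) < 1 := by
  have hle := isLogDerivation_valuationOf hp
  have hpoly := valuationOf_poly_le_one hp
  have hps := valuationOf_self_lt_one hp
  have h2 := valuationOf_two_le_one hp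
  have hqv := valuationOf_poly_eq_one hp hq
  set W := ofPoly (X - C e) * w with hW
  set U := logD τ with hU
  have hU1 : valuationOf hp U ≤ 1 := valuationOf_logD_le_one hp hτ
  have hDW : D W = w + ofPoly (X - C e) * D w := by
    rw [hW, D_mul, D_ofPoly, derivative_X_sub_C, map_one, one_mul]
  set r : RatFunc ℝ := 2 * (ofPoly q * (ofPoly (X - C e) * D U)) + 2 * (RatFunc.X * U)
    - RatFunc.C κ with hr
  have hr1 : valuationOf hp r ≤ 1 :=
    Valuation.map_sub_le _ (Valuation.map_add_le _ (map_mul_le_one h2 (map_mul_le_one hqv.le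
      (hle.lt U hU1).le)) (map_mul_le_one h2 (map_mul_le_one (valuationOf_X_le_one hp) hU1)))
      (valuationOf_C_le_one hp κ)
  rw [IsRiccatiSolution, hpq, hη] at h
  have key : ofPoly q * W ^ 2 + ofPoly q * (ofPoly (X - C e) * D W)
      + ofPoly (C γ * q + g * (X - C e)) * W + r * ofPoly (X - C e) = 0 := by
    rw [hDW, hr, hW, hU]
    simp only [map_add, map_mul, map_one] at h ⊢
    linear_combination (ofPoly (X - C e)) * h
  have hW1 : valuationOf hp W ≤ 1 :=
    regular_of_riccati hle.le hqv hqv.le (hpoly _) (map_mul_le_one hr1 hps.le) key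
  refine lt_one_or_lt_one_of_mul (lt_one_of_unit_mul hqv ?_)
  have key2 : ofPoly q * (W * (W + RatFunc.C γ)) = -(ofPoly q * (ofPoly (X - C e) * D W)
      + ofPoly g * (W * ofPoly (X - C e)) + r * ofPoly (X - C e)) := by
    simp only [map_add, map_mul, RatFunc.algebraMap_C] at key ⊢
    linear_combination key
  rw [key2, Valuation.map_neg]
  exact Valuation.map_add_lt _ (Valuation.map_add_lt _ (map_mul_lt_one hqv.le (hle.lt W hW1))
    (map_mul_lt_one (hpoly _) (map_mul_lt_one hW1 hps))) (map_mul_lt_one hr1 hps)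

/-- At an endpoint `e`, the residue of `w` is `-γ` if `w` has a pole there and `0` otherwise. -/
theorem IsRiccatiSolution.endpoint_residue {e : ℝ} (hp : Irreducible (X - C e)) {q g : ℝ[X]}
    {γ : ℝ} {τ : ℝ[X]} (hτ : ¬ (X - C e) ∣ τ) {α β κ : ℝ} {w : RatFunc ℝ}
    (h : IsRiccatiSolution τ α β κ w) (hq : ¬ (X - C e) ∣ q) (hpq : X ^ 2 - 1 = (X - C e) * q)
    (hη : etaPoly α β = C (γ + 1) * q + g * (X - C e)) :
    valuationOf hp (w + RatFunc.C (if w.denom.eval e = 0 then γ else 0) / ofPoly (X - C e))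
      ≤ 1 := by
  have e0 := ofPoly_ne_zero (X_sub_C_ne_zero e)
  have hreg : w.denom.eval e ≠ 0 ↔ valuationOf hp w ≤ 1 := by
    rw [← not_dvd_denom_iff, dvd_iff_isRoot, IsRoot.def]
  split_ifs with h0
  -- A vanishing residue would make w regular at e, against the assumed pole; only -γ remains.
  · rcases h.endpoint hp hτ hq hpq hη with h1 | h1
    · have h2 := valuationOf_div_self_le_one hp h1
      rw [mul_div_cancel_left₀ _ e0] at h2
      exact absurd h0 (hreg.2 h2)
    · have h2 := valuationOf_div_self_le_one hp h1
      rwa [add_div, mul_div_cancel_left₀ _ e0] at h2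
  · simpa using hreg.1 h0

/-! ### Residues at the zeros of `τ` -/

/-- The existence of one eigenpolynomial forces the indicial roots at the zeros of `τ` to be
integers. -/
theorem exists_indicial_root {p : ℝ[X]} (hp : Irreducible p) (hp1 : ¬ p ∣ X ^ 2 - 1)
    {τ : ℝ[X]} (hτ : τ ≠ 0) {α β κ : ℝ} {P : ℝ[X]} (hP : P ≠ 0)
    (h : IsRiccatiSolution τ α β κ (logD P - logD τ)) (m : ℕ)
    (hm : valuationOf hp (ofPoly p * logD τ - RatFunc.C (m : ℝ) * ofPoly (derivative p)) < 1) :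
    ∃ c : ℤ, c * (c - 1) = 2 * m := by
  obtain ⟨k, hk⟩ := exists_residue_logDeriv hp hP
  have hmain := h.generic hp hp1 hτ m hm
  set W := ofPoly p * (logD P - logD τ) with hW
  obtain ⟨c, hc⟩ : ∃ c : ℝ, c = k - m := ⟨_, rfl⟩
  set d := ofPoly (derivative p) with hd
  have hd1 : valuationOf hp d = 1 :=
    valuationOf_poly_eq_one hp (not_dvd_derivative_of_irreducible hp)
  have hWc : valuationOf hp (W - RatFunc.C c * d) < 1 := by
    have e : W - RatFunc.C c * d =
        (ofPoly p * (D (ofPoly P) / ofPoly P) - RatFunc.C (k : ℝ) * d)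
        - (ofPoly p * logD τ - RatFunc.C (m : ℝ) * d) := by
      rw [hW, hc, map_sub, logD]; ring
    rw [e]
    exact Valuation.map_sub_lt _ hk hm
  have hcd : valuationOf hp (RatFunc.C c * d) ≤ 1 :=
    map_mul_le_one (valuationOf_C_le_one hp c) hd1.le
  have hW1 : valuationOf hp W ≤ 1 := by
    have := Valuation.map_add_le _ hWc.le hcd
    rwa [sub_add_cancel] at this
  -- Substituting the residue c p' for W in the indicial congruence leaves a real constant times
  -- p'². A constant of valuation below 1 is zero.
  have hsmall : valuationOf hp (RatFunc.C (c * (c - 1) - 2 * m) * (d * d)) < 1 := by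
    have e : RatFunc.C (c * (c - 1) - 2 * m) * (d * d)
        = (W ^ 2 - d * W - 2 * RatFunc.C (m : ℝ) * d ^ 2)
          - (W + RatFunc.C c * d - d) * (W - RatFunc.C c * d) := by
      rw [map_sub, map_mul, map_sub, map_mul, map_one, show RatFunc.C (2 : ℝ) = 2 from map_ofNat _ 2]
      ring
    rw [e]
    exact Valuation.map_sub_lt _ hmain (map_mul_lt_one
      (Valuation.map_sub_le _ (Valuation.map_add_le _ hW1 hcd) hd1.le) hWc)
  rw [map_mul, map_mul, hd1, mul_one, mul_one] at hsmall
  have hzero : c * (c - 1) - 2 * m = 0 := by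
    by_contra hne
    exact absurd (valuationOf_C hp hne) hsmall.ne
  refine ⟨(k : ℤ) - m, ?_⟩
  have : (((k : ℤ) - m : ℤ) : ℝ) * ((((k : ℤ) - m : ℤ) : ℝ) - 1) = 2 * m := by
    push_cast
    rw [← hc]
    exact sub_eq_zero.1 hzero
  exact_mod_cast this

/-- For c ≤ -m-1 the product c(c-1) would be at least (m+1)(m+2) > 2m. -/
theorem neg_le_of_indicial {c : ℤ} {m : ℕ} (h : c * (c - 1) = 2 * m) : 0 ≤ c + m := by
  by_contra! hlt
  nlinarith

/-- At a prime other than `x ± 1`, the logarithmic derivative `w + τ'/τ` has a simple pole with a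
natural residue. -/
theorem exists_nat_residue {p : ℝ[X]} (hp : Irreducible p)
    (hp1 : ¬ p ∣ X ^ 2 - 1) {τ : ℝ[X]} (hτ : τ ≠ 0) {α β κ κ₀ : ℝ} {P : ℝ[X]} (hP : P ≠ 0)
    (h₀ : IsRiccatiSolution τ α β κ₀ (logD P - logD τ)) {w : RatFunc ℝ}
    (h : IsRiccatiSolution τ α β κ w) :
    ∃ n : ℕ, valuationOf hp (w + logD τ - RatFunc.C (n : ℝ) * logD p) ≤ 1 := by
  obtain ⟨m, hm⟩ := exists_residue_logDeriv hp hτ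
  obtain ⟨c, hc⟩ := exists_indicial_root hp hp1 hτ hP h₀ m hm
  have hmain := h.generic hp hp1 hτ m hm
  have e0 := ofPoly_ne_zero hp.ne_zero
  have hcR : (c : ℝ) * (c - 1) = 2 * m := by exact_mod_cast hc
  have hcF : RatFunc.C (c : ℝ) * (RatFunc.C (c : ℝ) - 1) = 2 * RatFunc.C (m : ℝ) := by
    rw [← map_one RatFunc.C, ← map_sub, ← map_mul, hcR, map_mul,
      show RatFunc.C (2 : ℝ) = 2 from map_ofNat _ 2]
  suffices key : ∀ c' : ℤ, c' * (c' - 1) = 2 * m →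
      valuationOf hp (ofPoly p * w - RatFunc.C (c' : ℝ) * ofPoly (derivative p)) < 1 →
      ∃ n : ℕ, valuationOf hp (w + logD τ - RatFunc.C (n : ℝ) * logD p) ≤ 1 by
    -- The two roots of c(c-1) = 2m add up to 1, so the quadratic splits with integer roots c and
    -- 1-c, and one factor must vanish modulo p.
    have e : (ofPoly p * w) ^ 2 - ofPoly (derivative p) * (ofPoly p * w)
        - 2 * RatFunc.C (m : ℝ) * ofPoly (derivative p) ^ 2
        = (ofPoly p * w - RatFunc.C (c : ℝ) * ofPoly (derivative p))
          * (ofPoly p * w - RatFunc.C ((1 - c : ℤ) : ℝ) * ofPoly (derivative p)) := by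
      push_cast
      rw [map_sub, map_one]
      linear_combination (ofPoly (derivative p) ^ 2) * hcF
    rw [e] at hmain
    rcases lt_one_or_lt_one_of_mul hmain with h1 | h1
    · exact key c hc h1
    · exact key (1 - c) (by linarith) h1
  intro c' hc' hlt
  obtain ⟨n, hn⟩ := Int.eq_ofNat_of_zero_le (neg_le_of_indicial hc')
  refine ⟨n, ?_⟩
  have hnR : (n : ℝ) = c' + m := by
    have : ((c' + m : ℤ) : ℝ) = ((n : ℤ) : ℝ) := by rw [hn]
    push_cast at this
    exact this.symm
  have e : w + logD τ - RatFunc.C (n : ℝ) * logD p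
      = ((ofPoly p * w - RatFunc.C (c' : ℝ) * ofPoly (derivative p))
        + (ofPoly p * logD τ - RatFunc.C (m : ℝ) * ofPoly (derivative p))) / ofPoly p := by
    rw [hnR, map_add, eq_div_iff e0, logD, logD, D_ofPoly p]
    field_simp
    ring
  rw [e]
  exact valuationOf_div_self_le_one hp (Valuation.map_add_lt _ hlt hm)

/-! ### Rational functions with natural residues -/

/-- A rational function all of whose poles are simple with natural residues is, up to a polynomial,
the logarithmic derivative of a polynomial. -/
theorem exists_logD_of_nat_residues (Q : ℝ[X]) (s : RatFunc ℝ)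
    (h : ∀ (p : ℝ[X]) (hp : Irreducible p), ∃ n : ℕ, (p ∣ Q → n = 0) ∧
      valuationOf hp (s - RatFunc.C (n : ℝ) * logD p) ≤ 1) :
    ∃ σ A : ℝ[X], σ ≠ 0 ∧ IsCoprime σ Q ∧ s = ofPoly A + logD σ := by
  obtain ⟨N, hN⟩ : ∃ N, s.denom.natDegree = N := ⟨_, rfl⟩
  -- Subtracting n p'/p removes the pole at p and creates none elsewhere, so the degree of the
  -- denominator drops.
  induction N using Nat.strong_induction_on generalizing s with
  | _ N ih =>
  by_cases hall : ∀ (p : ℝ[X]) (hp : Irreducible p), valuationOf hp s ≤ 1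
  · obtain ⟨A, rfl⟩ := exists_poly_of_regular hall
    exact ⟨1, A, one_ne_zero, isCoprime_one_left, by rw [logD_one, add_zero]⟩
  push Not at hall
  obtain ⟨p, hp, hps⟩ := hall
  have hpd : p ∣ s.denom := by
    by_contra hpd
    exact absurd ((not_dvd_denom_iff hp).1 hpd) (not_le.2 hps)
  obtain ⟨n, hnQ, hn⟩ := h p hp
  have hcop : IsCoprime (p ^ n) Q := by
    by_cases hpQ : p ∣ Q
    · rw [hnQ hpQ, pow_zero]
      exact isCoprime_one_left
    · exact ((hp.coprime_iff_not_dvd).2 hpQ).pow_left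
  set s₂ := s - RatFunc.C (n : ℝ) * logD p with hs₂
  have e0 := ofPoly_ne_zero hp.ne_zero
  have hp₂ : ¬ p ∣ s₂.denom := (not_dvd_denom_iff hp).2 hn
  have hdvd : s₂.denom ∣ s.denom := by
    obtain ⟨R, hR⟩ := hpd
    have hR0 : ofPoly R ≠ 0 := ofPoly_ne_zero fun h0 => s.denom_ne_zero (by rw [hR, h0, mul_zero])
    have e : s₂ = ofPoly (s.num - C (n : ℝ) * derivative p * R) / ofPoly s.denom := by
      have hs := RatFunc.num_div_denom s
      rw [hs₂]
      nth_rw 1 [← hs]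
      rw [logD, D_ofPoly, hR]
      simp only [map_sub, map_mul, RatFunc.algebraMap_C]
      field_simp
    rw [e]
    exact RatFunc.denom_div_dvd _ _
  have hlt : s₂.denom.natDegree < N := by
    rw [← hN]
    obtain ⟨R, hR⟩ := hdvd
    have hR0 : R ≠ 0 := fun h0 => s.denom_ne_zero (by rw [hR, h0, mul_zero])
    rw [hR, natDegree_mul s₂.denom_ne_zero hR0]
    have hRu : ¬ IsUnit R := fun hu => hp₂ (by rwa [hR, hu.dvd_mul_right] at hpd)
    have := natDegree_pos_iff_degree_pos.2 (degree_pos_of_ne_zero_of_nonunit hR0 hRu)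
    omega
  obtain ⟨σ, A, hσ, hσQ, hσs⟩ := ih _ hlt s₂ (fun q hq => by
    obtain ⟨k, hkQ, hk⟩ := h q hq
    -- At associates of p the pole is already gone, so the required residue is reset to 0.
    by_cases hqp : q ∣ p
    · refine ⟨0, fun _ => rfl, ?_⟩
      rw [Nat.cast_zero, map_zero, zero_mul, sub_zero, ← not_dvd_denom_iff]
      exact fun hd => hp₂ (((hq.dvd_irreducible_iff_associated hp).1 hqp).symm.dvd.trans hd)
    · refine ⟨k, hkQ, ?_⟩
      rw [hs₂, sub_right_comm]
      exact Valuation.map_sub_le _ hk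
        (map_mul_le_one (valuationOf_C_le_one hq _) (valuationOf_logD_le_one hq hqp))) rfl
  refine ⟨p ^ n * σ, A, mul_ne_zero (pow_ne_zero n hp.ne_zero) hσ, hcop.mul_left hσQ, ?_⟩
  rw [logD_mul (pow_ne_zero n hp.ne_zero) hσ, logD_pow hp.ne_zero]
  linear_combination hσs + hs₂

theorem eval_ne_zero_of_isCoprime {σ Q : ℝ[X]} (h : IsCoprime σ Q) {e : ℝ} (he : Q.eval e = 0) :
    σ.eval e ≠ 0 := by
  intro h0
  obtain ⟨a, b, hab⟩ := h
  have := congrArg (eval e) hab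
  simp [h0, he] at this

/-! ### The shape of the solutions of the Riccati equation -/

/-- The logarithmic derivative of `(1 - x)^{-a} (1 + x)^{-b}`. -/
def muLogDeriv (a b : ℝ) : RatFunc ℝ :=
  RatFunc.C (-a) / ofPoly (X - C 1) + RatFunc.C (-b) / ofPoly (X - C (-1))

theorem hasValueInfty_muLogDeriv (a b : ℝ) :
    HasValueInfty (RatFunc.X * muLogDeriv a b) (-a + -b) := by
  rw [muLogDeriv, mul_add]
  exact HasValueInfty.add (residue_infty_simple_pole (-a) 1) (residue_infty_simple_pole (-b) (-1))

theorem hasValueInfty_logD {P : ℝ[X]} (hP : P ≠ 0) :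
    HasValueInfty (RatFunc.X * logD P) (P.natDegree : ℝ) :=
  residue_infty_logDeriv hP

theorem valuationOf_simple_pole_le_one {p : ℝ[X]} (hp : Irreducible p) {e : ℝ}
    (h : ¬ p ∣ X - C e) (a : ℝ) : valuationOf hp (RatFunc.C a / ofPoly (X - C e)) ≤ 1 := by
  rw [map_div₀, valuationOf_poly_eq_one hp h, div_one]
  exact valuationOf_C_le_one hp a

theorem valuationOf_le_one_of_associated {p q : ℝ[X]} (hp : Irreducible p) (hq : Irreducible q)
    (h : p ∣ q) {f : RatFunc ℝ} (hf : valuationOf hq f ≤ 1) : valuationOf hp f ≤ 1 := by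
  rw [← not_dvd_denom_iff] at hf ⊢
  exact fun hd => hf (((hp.dvd_irreducible_iff_associated hq).1 h).symm.dvd.trans hd)

theorem not_dvd_X_sub_C {e e' : ℝ} (h : e ≠ e') : ¬ (X - C e) ∣ (X - C e' : ℝ[X]) := by
  intro hd
  rw [dvd_iff_isRoot, IsRoot.def, eval_sub, eval_X, eval_C] at hd
  exact h (sub_eq_zero.1 hd)

theorem regular_at_endpoint {p τ : ℝ[X]} (hp : Irreducible p) {e e' a b : ℝ} (hne : e ≠ e')
    (hpe : p ∣ X - C e) (hτ : τ.eval e ≠ 0) {w : RatFunc ℝ}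
    (h : valuationOf (irreducible_X_sub_C e) (w + RatFunc.C a / ofPoly (X - C e)) ≤ 1) :
    valuationOf hp (w + logD τ
      - (RatFunc.C (-a) / ofPoly (X - C e) + RatFunc.C (-b) / ofPoly (X - C e'))) ≤ 1 := by
  refine valuationOf_le_one_of_associated hp (irreducible_X_sub_C e) hpe ?_
  have key : w + logD τ
      - (RatFunc.C (-a) / ofPoly (X - C e) + RatFunc.C (-b) / ofPoly (X - C e'))
      = (w + RatFunc.C a / ofPoly (X - C e)) + logD τ - RatFunc.C (-b) / ofPoly (X - C e') := by
    rw [map_neg RatFunc.C a]; ring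
  rw [key]
  exact Valuation.map_sub_le _ (Valuation.map_add_le _ h
    (valuationOf_logD_le_one _ (by rwa [dvd_iff_isRoot, IsRoot.def])))
    (valuationOf_simple_pole_le_one _ (not_dvd_X_sub_C hne) _)

theorem X_sq_sub_one_eq : (X ^ 2 - 1 : ℝ[X]) = (X - C 1) * (X - C (-1)) := by
  rw [map_neg, map_one]; ring

theorem regular_muLogDeriv {p : ℝ[X]} (hp : Irreducible p) (hp1 : ¬ p ∣ X ^ 2 - 1) (a b : ℝ) :
    valuationOf hp (muLogDeriv a b) ≤ 1 := by
  rw [X_sq_sub_one_eq] at hp1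
  exact Valuation.map_add_le _
    (valuationOf_simple_pole_le_one hp (fun hd => hp1 (hd.mul_right _)) _)
    (valuationOf_simple_pole_le_one hp (fun hd => hp1 (hd.mul_left _)) _)

/-- Subtracting `muLogDeriv` removes the poles at 1 and -1, so no factor of σ is needed there. The
coprimality with x²-1 later yields nonvanishing at both endpoints. -/
theorem exists_form_of_residues {τ : ℝ[X]} (hτ1 : τ.eval 1 ≠ 0) (hτ2 : τ.eval (-1) ≠ 0)
    {w : RatFunc ℝ} {a b : ℝ}
    (h : ∀ (p : ℝ[X]) (hp : Irreducible p), ¬ p ∣ X ^ 2 - 1 →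
      ∃ n : ℕ, valuationOf hp (w + logD τ - RatFunc.C (n : ℝ) * logD p) ≤ 1)
    (h1 : valuationOf (irreducible_X_sub_C 1) (w + RatFunc.C a / ofPoly (X - C 1)) ≤ 1)
    (h2 : valuationOf (irreducible_X_sub_C (-1)) (w + RatFunc.C b / ofPoly (X - C (-1))) ≤ 1) :
    ∃ σ A : ℝ[X], σ ≠ 0 ∧ IsCoprime σ (X ^ 2 - 1) ∧
      w + logD τ - muLogDeriv a b = ofPoly A + logD σ := by
  refine exists_logD_of_nat_residues (X ^ 2 - 1) _ fun p hp => ?_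
  by_cases hp1 : p ∣ X ^ 2 - 1
  · refine ⟨0, fun _ => rfl, ?_⟩
    rw [Nat.cast_zero, map_zero, zero_mul, sub_zero]
    rw [X_sq_sub_one_eq] at hp1
    rcases hp.prime.dvd_or_dvd hp1 with hd | hd
    · exact regular_at_endpoint hp (by norm_num) hd hτ1 h1
    · rw [muLogDeriv, add_comm (_ / _)]
      exact regular_at_endpoint hp (by norm_num) hd hτ2 h2
  · obtain ⟨n, hn⟩ := h p hp hp1
    refine ⟨n, fun hd => absurd hd hp1, ?_⟩
    rw [sub_right_comm]
    exact Valuation.map_sub_le _ hn (regular_muLogDeriv hp hp1 a b)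

theorem IsRiccatiSolution.residue_one {τ : ℝ[X]} (hτ1 : τ.eval 1 ≠ 0) {α β κ : ℝ} {w : RatFunc ℝ}
    (h : IsRiccatiSolution τ α β κ w) : valuationOf (irreducible_X_sub_C 1)
      (w + RatFunc.C (if w.denom.eval 1 = 0 then α else 0) / ofPoly (X - C 1)) ≤ 1 := by
  have hη : etaPoly α β = C (α + 1) * (X - C (-1)) + C (β + 1) * (X - C 1) := by
    rw [etaPoly, map_neg C, map_one C]; ring
  exact h.endpoint_residue (irreducible_X_sub_C 1) (by rwa [dvd_iff_isRoot, IsRoot.def])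
    (not_dvd_X_sub_C (by norm_num)) X_sq_sub_one_eq hη

theorem IsRiccatiSolution.residue_neg_one {τ : ℝ[X]} (hτ2 : τ.eval (-1) ≠ 0) {α β κ : ℝ}
    {w : RatFunc ℝ} (h : IsRiccatiSolution τ α β κ w) : valuationOf (irreducible_X_sub_C (-1))
      (w + RatFunc.C (if w.denom.eval (-1) = 0 then β else 0) / ofPoly (X - C (-1))) ≤ 1 := by
  have hη : etaPoly α β = C (β + 1) * (X - C 1) + C (α + 1) * (X - C (-1)) := by
    rw [etaPoly, map_neg C, map_one C]; ring
  exact h.endpoint_residue (irreducible_X_sub_C (-1)) (by rwa [dvd_iff_isRoot, IsRoot.def])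
    (not_dvd_X_sub_C (by norm_num)) (by rw [X_sq_sub_one_eq, mul_comm]) hη

theorem exists_form {τ : ℝ[X]} (hτ1 : τ.eval 1 ≠ 0) (hτ2 : τ.eval (-1) ≠ 0)
    {α β κ κ₀ : ℝ} {P : ℝ[X]} (hP : P ≠ 0)
    (h₀ : IsRiccatiSolution τ α β κ₀ (logD P - logD τ)) {w : RatFunc ℝ}
    (h : IsRiccatiSolution τ α β κ w) {a b : ℝ}
    (ha : a = if w.denom.eval 1 = 0 then α else 0)
    (hb : b = if w.denom.eval (-1) = 0 then β else 0) :
    ∃ σ : ℝ[X], σ.eval 1 ≠ 0 ∧ σ.eval (-1) ≠ 0 ∧ w = muLogDeriv a b + logD σ - logD τ ∧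
      κ = qrDegree w * (qrDegree w + α + β + 1) ∧
      qrDegree w = -a - b + σ.natDegree - τ.natDegree := by
  have hτ : τ ≠ 0 := by rintro rfl; simp at hτ1
  have hres1 := h.residue_one hτ1
  have hres2 := h.residue_neg_one hτ2
  rw [← ha] at hres1
  rw [← hb] at hres2
  obtain ⟨σ, A, hσ, hcop, hs⟩ := exists_form_of_residues hτ1 hτ2
    (fun p hp hp1 => exists_nat_residue hp hp1 hτ hP h₀ h) hres1 hres2
  obtain ⟨hle, hκ⟩ := h.infty hτ
  have hform : HasValueInfty (RatFunc.X * (muLogDeriv a b + logD σ - logD τ))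
      (-a + -b + σ.natDegree - τ.natDegree) := by
    rw [mul_sub, mul_add]
    exact ((hasValueInfty_muLogDeriv a b).add (hasValueInfty_logD hσ)).sub
      (hasValueInfty_logD hτ)
  -- Both xw and x times the expected form are bounded at infinity, so A is O(1/x).
  have hA : A = 0 := by
    refine poly_eq_zero_of_valuationInfty_lt_one ?_
    have e : ofPoly A = (RatFunc.X * w - RatFunc.X * (muLogDeriv a b + logD σ - logD τ))
        * RatFunc.X⁻¹ := by
      have hX : (RatFunc.X : RatFunc ℝ) ≠ 0 := RatFunc.X_ne_zero
      field_simp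
      linear_combination -hs
    rw [e]
    exact map_mul_lt_one (Valuation.map_sub_le _ hle hform.le_one) valuationInfty_X_inv_lt_one
  have hw : w = muLogDeriv a b + logD σ - logD τ := by
    rw [hA, map_zero, zero_add] at hs
    linear_combination hs
  refine ⟨σ, eval_ne_zero_of_isCoprime hcop (by simp), eval_ne_zero_of_isCoprime hcop (by simp),
    hw, hκ _ (qrDegree_spec hle), ?_⟩
  rw [← hw] at hform
  rw [qrDegree_eq hform]
  ring

open Filter Topology

/-! ### Values of rational functions -/

/-- `f` has no pole at `x`. -/
def RegularAt (f : RatFunc ℝ) (x : ℝ) : Prop := f.denom.eval x ≠ 0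

theorem valueAt_eq (f : RatFunc ℝ) (x : ℝ) : valueAt f x = f.num.eval x / f.denom.eval x := by
  simp [RatFunc.eval, eval₂_id]

theorem finite_not_regularAt (f : RatFunc ℝ) : {x | ¬ RegularAt f x}.Finite := by
  refine (f.denom.roots.toFinset.finite_toSet).subset fun x hx => ?_
  simpa [RegularAt, f.denom_ne_zero] using hx

theorem finite_eval_eq_zero {P : ℝ[X]} (hP : P ≠ 0) : {x | P.eval x = 0}.Finite := by
  refine (P.roots.toFinset.finite_toSet).subset fun x hx => ?_
  simpa [hP] using hx

theorem regularAt_of_dvd {f : RatFunc ℝ} {Q : ℝ[X]} {x : ℝ} (h : f.denom ∣ Q)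
    (hQ : Q.eval x ≠ 0) : RegularAt f x := by
  rintro h0
  obtain ⟨R, rfl⟩ := h
  rw [eval_mul, h0, zero_mul] at hQ
  exact hQ rfl

theorem regularAt_div {P Q : ℝ[X]} {x : ℝ} (hQ : Q.eval x ≠ 0) :
    RegularAt (ofPoly P / ofPoly Q) x :=
  regularAt_of_dvd (RatFunc.denom_div_dvd _ _) hQ

theorem regularAt_C (c x : ℝ) : RegularAt (RatFunc.C c) x := by
  simp [RegularAt]

theorem RegularAt.add {f g : RatFunc ℝ} {x : ℝ} (hf : RegularAt f x) (hg : RegularAt g x) :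
    RegularAt (f + g) x :=
  regularAt_of_dvd (RatFunc.denom_add_dvd f g) (by rw [eval_mul]; exact mul_ne_zero hf hg)

theorem RegularAt.mul {f g : RatFunc ℝ} {x : ℝ} (hf : RegularAt f x) (hg : RegularAt g x) :
    RegularAt (f * g) x :=
  regularAt_of_dvd (RatFunc.denom_mul_dvd f g) (by rw [eval_mul]; exact mul_ne_zero hf hg)

theorem RegularAt.neg {f : RatFunc ℝ} {x : ℝ} (hf : RegularAt f x) : RegularAt (-f) x := by
  have h := (regularAt_C (-1) x).mul hf
  simpa using h

theorem RegularAt.sub {f g : RatFunc ℝ} {x : ℝ} (hf : RegularAt f x) (hg : RegularAt g x) :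
    RegularAt (f - g) x := by
  rw [sub_eq_add_neg]
  exact hf.add hg.neg

theorem RegularAt.D {f : RatFunc ℝ} {x : ℝ} (hf : RegularAt f x) : RegularAt (D f) x := by
  rw [XJacobi.D, ← map_pow]
  exact regularAt_div (by rw [eval_pow]; exact pow_ne_zero 2 hf)

theorem valueAt_add {f g : RatFunc ℝ} {x : ℝ} (hf : RegularAt f x) (hg : RegularAt g x) :
    valueAt (f + g) x = valueAt f x + valueAt g x :=
  RatFunc.eval_add _ _ (by simpa [RegularAt, eval₂_id] using hf) (by simpa [RegularAt, eval₂_id] using hg)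

theorem valueAt_mul {f g : RatFunc ℝ} {x : ℝ} (hf : RegularAt f x) (hg : RegularAt g x) :
    valueAt (f * g) x = valueAt f x * valueAt g x :=
  RatFunc.eval_mul _ _ (by simpa [RegularAt, eval₂_id] using hf) (by simpa [RegularAt, eval₂_id] using hg)

theorem valueAt_C (c x : ℝ) : valueAt (RatFunc.C c) x = c :=
  RatFunc.eval_C _ _

theorem valueAt_sub {f g : RatFunc ℝ} {x : ℝ} (hf : RegularAt f x) (hg : RegularAt g x) :
    valueAt (f - g) x = valueAt f x - valueAt g x := by
  have h := valueAt_add (hf.sub hg) hg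
  rw [sub_add_cancel] at h
  linarith

theorem valueAt_div {P Q : ℝ[X]} {x : ℝ} (hQ : Q.eval x ≠ 0) :
    valueAt (ofPoly P / ofPoly Q) x = P.eval x / Q.eval x := by
  have hQ0 : Q ≠ 0 := by rintro rfl; simp at hQ
  have hr : (ofPoly P / ofPoly Q : RatFunc ℝ).denom.eval x ≠ 0 := regularAt_div hQ
  obtain ⟨f, hf⟩ : ∃ f, f = ofPoly P / ofPoly Q := ⟨_, rfl⟩
  rw [← hf] at hr ⊢
  have h1 : ofPoly f.num / ofPoly f.denom = ofPoly P / ofPoly Q :=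
    (RatFunc.num_div_denom f).trans hf
  rw [div_eq_div_iff (ofPoly_ne_zero f.denom_ne_zero) (ofPoly_ne_zero hQ0), ← map_mul,
    ← map_mul] at h1
  have h2 := congrArg (eval x) (RatFunc.algebraMap_injective ℝ h1)
  rw [eval_mul, eval_mul] at h2
  rw [valueAt_eq, div_eq_div_iff hr hQ, h2]

theorem hasDerivAt_valueAt {f : RatFunc ℝ} {x : ℝ} (hf : RegularAt f x) :
    HasDerivAt (valueAt f) (valueAt (D f) x) x := by
  have h := (f.num.hasDerivAt x).div (f.denom.hasDerivAt x) hf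
  have hfun : valueAt f = (fun y => f.num.eval y) / (fun y => f.denom.eval y) := by
    funext y; exact valueAt_eq f y
  rw [hfun]
  refine h.congr_deriv ?_
  rw [XJacobi.D, ← map_pow, valueAt_div (by rw [eval_pow]; exact pow_ne_zero 2 hf)]
  simp

/-- After discarding the finitely many poles, cross-multiplication gives polynomials that agree at
infinitely many points. -/
theorem eq_of_valueAt_eq {f g : RatFunc ℝ} {s : Set ℝ} (hs : s.Infinite)
    (h : ∀ x ∈ s, valueAt f x = valueAt g x) : f = g := by
  have hfin := (finite_not_regularAt f).union (finite_not_regularAt g)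
  have key : f.num * g.denom = g.num * f.denom := by
    refine eq_of_infinite_eval_eq _ _ ((hs.sdiff hfin).mono fun x hx => ?_)
    have hf : RegularAt f x := by_contra fun h0 => hx.2 (Or.inl h0)
    have hg : RegularAt g x := by_contra fun h0 => hx.2 (Or.inr h0)
    have h1 := h x hx.1
    rw [valueAt_eq, valueAt_eq, div_eq_div_iff hf hg] at h1
    simpa using h1
  rw [← RatFunc.num_div_denom f, ← RatFunc.num_div_denom g,
    div_eq_div_iff (ofPoly_ne_zero f.denom_ne_zero) (ofPoly_ne_zero g.denom_ne_zero), ← map_mul,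
    ← map_mul, key]

/-! ### From eigenfunctions to the Riccati equation -/

theorem infinite_of_isOpen {J : Set ℝ} (hJ : IsOpen J) (hn : J.Nonempty) : J.Infinite := by
  obtain ⟨x, hx⟩ := hn
  exact infinite_of_mem_nhds x (hJ.mem_nhds hx)

/-- Off a finite set φ'' = (w' + w²)φ with φ nonzero, so dividing by φ gives the identity at
infinitely many points, hence in ℝ(x). -/
theorem riccati_of_eigenfunction {T : DiffOp} {κ : ℝ} {J : Set ℝ} (hJ : IsOpen J)
    (hn : J.Nonempty) {φ : ℝ → ℝ} {w : RatFunc ℝ} (h : T.IsQREigenfunctionOn κ φ J w) :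
    T.p * (D w + w ^ 2) + T.q * w + T.r = RatFunc.C κ := by
  obtain ⟨⟨-, S, hS, hφ⟩, S', hS', hT⟩ := h
  have hfin := (hS.union hS').union ((finite_not_regularAt w).union
    ((finite_not_regularAt T.p).union ((finite_not_regularAt T.q).union
      (finite_not_regularAt T.r))))
  refine eq_of_valueAt_eq ((infinite_of_isOpen hJ hn).sdiff hfin) fun x hx => ?_
  obtain ⟨hxJ, hx⟩ := hx
  simp only [Set.mem_union, Set.mem_ofPred_eq, not_or, not_not] at hx
  obtain ⟨⟨hxS, hxS'⟩, hw, hp, hq, hr⟩ := hx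
  obtain ⟨h0, hd⟩ := hφ x ⟨hxJ, hxS⟩
  -- The second derivative needs φ' = wφ near x; the exceptional set is finite, hence closed.
  have hev : deriv φ =ᶠ[𝓝 x] fun y => valueAt w y * φ y := by
    filter_upwards [(hJ.sdiff hS.isClosed).mem_nhds ⟨hxJ, hxS⟩] with y hy
    exact (hφ y hy).2.deriv
  have hdd : deriv (deriv φ) x = valueAt (D w) x * φ x + valueAt w x * (valueAt w x * φ x) := by
    rw [hev.deriv_eq]
    exact ((hasDerivAt_valueAt hw).mul hd).deriv
  have happ := hT x ⟨hxJ, hxS'⟩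
  rw [DiffOp.appFun, hdd, hd.deriv] at happ
  rw [sq, valueAt_add ((hp.mul (hw.D.add (hw.mul hw))).add (hq.mul hw)) hr,
    valueAt_add (hp.mul (hw.D.add (hw.mul hw))) (hq.mul hw), valueAt_mul hp
    (hw.D.add (hw.mul hw)), valueAt_add hw.D (hw.mul hw), valueAt_mul hw hw, valueAt_mul hq hw,
    valueAt_C]
  refine mul_right_cancel₀ h0 ?_
  linear_combination happ

/-! ### Branches of powers -/

theorem branchPow_intCast (n : ℤ) (t : ℝ) : branchPow t n = t ^ n := by
  rw [branchPow, if_pos ⟨n, rfl⟩, Real.rpow_intCast]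

/-- `Real.log` is log |t|, so one formula covers both half-lines. -/
theorem branchPow_eq_exp {a t : ℝ} (ha : a ∉ Set.range (Int.cast : ℤ → ℝ)) (ht : t ≠ 0) :
    branchPow t a = Real.exp (Real.log t * a) := by
  rw [branchPow, if_neg ha, Real.rpow_def_of_pos (abs_pos.2 ht), Real.log_abs]

theorem branchPow_ne_zero {a t : ℝ} (ht : t ≠ 0) : branchPow t a ≠ 0 := by
  by_cases ha : a ∈ Set.range (Int.cast : ℤ → ℝ)
  · obtain ⟨n, rfl⟩ := ha
    rw [branchPow_intCast]
    exact zpow_ne_zero n ht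
  · rw [branchPow_eq_exp ha ht]
    exact Real.exp_ne_zero _

theorem hasDerivAt_branchPow {a t : ℝ} (ht : t ≠ 0) :
    HasDerivAt (fun s => branchPow s a) (a / t * branchPow t a) t := by
  by_cases ha : a ∈ Set.range (Int.cast : ℤ → ℝ)
  · obtain ⟨n, rfl⟩ := ha
    simp only [branchPow_intCast]
    refine (hasDerivAt_zpow n t (Or.inl ht)).congr_deriv ?_
    rw [zpow_sub_one₀ ht]
    field_simp
  · have h := ((Real.hasDerivAt_log ht).mul_const a).exp
    rw [branchPow_eq_exp ha ht]
    refine (h.congr_of_eventuallyEq ?_).congr_deriv ?_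
    · filter_upwards [isOpen_ne.mem_nhds ht] with s hs
      exact branchPow_eq_exp ha hs
    · field_simp

theorem analyticAt_log_of_ne_zero {t : ℝ} (ht : t ≠ 0) : AnalyticAt ℝ Real.log t := by
  have h : Real.log = fun s => Real.log (s ^ 2) * (1 / 2) := by
    funext s
    rw [Real.log_pow]
    push_cast
    ring
  rw [h]
  exact ((analyticAt_id.pow 2).log (show 0 < t ^ 2 by positivity)).mul analyticAt_const

theorem meromorphicAt_branchPow {a t : ℝ} (h : t = 0 → a ∈ Set.range (Int.cast : ℤ → ℝ)) :
    MeromorphicAt (fun s => branchPow s a) t := by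
  by_cases ha : a ∈ Set.range (Int.cast : ℤ → ℝ)
  · obtain ⟨n, rfl⟩ := ha
    simp only [branchPow_intCast]
    exact (MeromorphicAt.id t).zpow n
  · have ht : t ≠ 0 := fun h0 => ha (h h0)
    have hd : AnalyticAt ℝ (fun s => Real.exp (Real.log s * a)) t :=
      ((analyticAt_log_of_ne_zero ht).mul analyticAt_const).rexp
    refine (hd.congr ?_).meromorphicAt
    filter_upwards [isOpen_ne.mem_nhds ht] with s hs
    exact (branchPow_eq_exp ha hs).symm

/-! ### The gauge factors -/

/-- The function `(1 - x)^{-a} (1 + x)^{-b}`. -/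
def jacobiWeight (a b x : ℝ) : ℝ := branchPow (1 - x) (-a) * branchPow (1 + x) (-b)

/-- An endpoint without a pole gets exponent 0, whose branch is 1 even at t = 0, so the four types
become a single weight. -/
theorem mu_asympType (α β : ℝ) (w : RatFunc ℝ) : mu α β (asympType w)
    = jacobiWeight (if w.denom.eval 1 = 0 then α else 0)
      (if w.denom.eval (-1) = 0 then β else 0) := by
  have h0 : ∀ t : ℝ, branchPow t (-0) = 1 := fun t => by
    have := branchPow_intCast 0 t
    simpa using this
  funext x
  rw [asympType, jacobiWeight]
  split_ifs <;> simp only [mu, h0, one_mul, mul_one]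

theorem muDegree_asympType (α β : ℝ) (w : RatFunc ℝ) : muDegree α β (asympType w)
    = -(if w.denom.eval 1 = 0 then α else 0) - (if w.denom.eval (-1) = 0 then β else 0) := by
  rw [asympType]
  split_ifs <;> simp [muDegree]

theorem eval_X_sub_C_ne_zero {x e : ℝ} (h : x ≠ e) : (X - C e).eval x ≠ 0 := by
  simpa [sub_eq_zero] using h

theorem valueAt_muLogDeriv {a b x : ℝ} (h1 : x ≠ 1) (h2 : x ≠ -1) :
    valueAt (muLogDeriv a b) x = -a / (x - 1) + -b / (x + 1) := by
  simp only [muLogDeriv, ← RatFunc.algebraMap_C]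
  rw [valueAt_add (regularAt_div (eval_X_sub_C_ne_zero h1))
    (regularAt_div (eval_X_sub_C_ne_zero h2)), valueAt_div (eval_X_sub_C_ne_zero h1),
    valueAt_div (eval_X_sub_C_ne_zero h2)]
  simp

theorem regularAt_muLogDeriv {a b x : ℝ} (h1 : x ≠ 1) (h2 : x ≠ -1) :
    RegularAt (muLogDeriv a b) x := by
  simp only [muLogDeriv, ← RatFunc.algebraMap_C]
  exact (regularAt_div (eval_X_sub_C_ne_zero h1)).add (regularAt_div (eval_X_sub_C_ne_zero h2))

theorem regularAt_logD {P : ℝ[X]} {x : ℝ} (h : P.eval x ≠ 0) : RegularAt (logD P) x := by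
  rw [logD, D_ofPoly]
  exact regularAt_div h

theorem valueAt_logD {P : ℝ[X]} {x : ℝ} (h : P.eval x ≠ 0) :
    valueAt (logD P) x = (derivative P).eval x / P.eval x := by
  rw [logD, D_ofPoly, valueAt_div h]

theorem jacobiWeight_ne_zero {a b x : ℝ} (h1 : x ≠ 1) (h2 : x ≠ -1) : jacobiWeight a b x ≠ 0 :=
  mul_ne_zero (branchPow_ne_zero (sub_ne_zero.2 h1.symm))
    (branchPow_ne_zero fun h => h2 (by linarith))

theorem hasDerivAt_jacobiWeight {a b x : ℝ} (h1 : x ≠ 1) (h2 : x ≠ -1) :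
    HasDerivAt (jacobiWeight a b) (valueAt (muLogDeriv a b) x * jacobiWeight a b x) x := by
  have e1 : 1 - x ≠ 0 := sub_ne_zero.2 h1.symm
  have e1' : x - 1 ≠ 0 := sub_ne_zero.2 h1
  have e2 : 1 + x ≠ 0 := fun h => h2 (by linarith)
  have e2' : x + 1 ≠ 0 := fun h => h2 (by linarith)
  have d1 := (hasDerivAt_branchPow (a := -a) e1).comp x ((hasDerivAt_id x).const_sub 1)
  have d2 := (hasDerivAt_branchPow (a := -b) e2).comp x ((hasDerivAt_id x).const_add 1)
  refine (d1.mul d2).congr_deriv ?_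
  rw [valueAt_muLogDeriv h1 h2, jacobiWeight]
  simp only [Function.comp_apply]
  have f1 : -a / (1 - x) = - (-a / (x - 1)) := by
    rw [← neg_sub x 1, div_neg]
  rw [f1, add_comm 1 x]
  ring

theorem meromorphicAt_jacobiWeight {a b x : ℝ} (h1 : x = 1 → a ∈ Set.range (Int.cast : ℤ → ℝ))
    (h2 : x = -1 → b ∈ Set.range (Int.cast : ℤ → ℝ)) : MeromorphicAt (jacobiWeight a b) x := by
  have hneg : ∀ {c : ℝ}, c ∈ Set.range (Int.cast : ℤ → ℝ) →
      -c ∈ Set.range (Int.cast : ℤ → ℝ) := by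
    rintro _ ⟨n, rfl⟩
    exact ⟨-n, by push_cast; rfl⟩
  have m1 : MeromorphicAt (fun s => branchPow s (-a)) (1 - x) :=
    meromorphicAt_branchPow fun h => hneg (h1 (by linarith))
  have m2 : MeromorphicAt (fun s => branchPow s (-b)) (1 + x) :=
    meromorphicAt_branchPow fun h => hneg (h2 (by linarith))
  exact (m1.comp_analyticAt (g := fun s : ℝ => 1 - s)
    (analyticAt_const.sub analyticAt_id)).mul (m2.comp_analyticAt (g := fun s : ℝ => 1 + s)
    (analyticAt_const.add analyticAt_id))

/-! ### Meromorphic solutions of first order equations -/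

/-- At a simple pole of its logarithmic derivative, a meromorphic function has integer residue. -/
theorem residue_mem_range_intCast {φ : ℝ → ℝ} {e a : ℝ} {r : RatFunc ℝ} (hφ : MeromorphicAt φ e)
    (hr : RegularAt r e) (h : ∀ᶠ x in 𝓝[≠] e, φ x ≠ 0 ∧
      HasDerivAt φ ((a / (x - e) + valueAt r x) * φ x) x) :
    a ∈ Set.range (Int.cast : ℤ → ℝ) := by
  have hne : meromorphicOrderAt φ e ≠ ⊤ :=
    (meromorphicOrderAt_ne_top_iff_eventually_ne_zero hφ).2 (h.mono fun x hx => hx.1)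
  obtain ⟨g, hg, hg0, hφg⟩ := (meromorphicOrderAt_ne_top_iff hφ).1 hne
  set n := (meromorphicOrderAt φ e).untop₀ with hn
  -- Write φ = (x-e)^n g with g analytic and g(e) ≠ 0, and compare the two expressions for φ'.
  -- Letting x tend to e gives n g(e) = a g(e).
  have key : ∀ᶠ x in 𝓝[≠] e,
      (n : ℝ) * g x + (x - e) * deriv g x = (a + (x - e) * valueAt r x) * g x := by
    have hga : ∀ᶠ x in 𝓝[≠] e, AnalyticAt ℝ g x :=
      hg.eventually_analyticAt.filter_mono nhdsWithin_le_nhds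
    have hφg' := eventually_eventually_nhdsWithin.2 hφg
    filter_upwards [h, hφg', hφg, hga, self_mem_nhdsWithin] with x hx hev hxg hgx hxe
    have hx0 : x - e ≠ 0 := sub_ne_zero.2 hxe
    have hev' : φ =ᶠ[𝓝 x] fun z => (z - e) ^ n • g z := by
      rwa [IsOpen.nhdsWithin_eq isOpen_compl_singleton hxe] at hev
    have hz : HasDerivAt (fun z : ℝ => (z - e) ^ n) (n * (x - e) ^ (n - 1)) x := by
      exact ((hasDerivAt_zpow n (x - e) (Or.inl hx0)).comp x
        ((hasDerivAt_id x).sub_const e)).congr_deriv (mul_one _)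
    have hd := (hz.mul hgx.differentiableAt.hasDerivAt).congr_of_eventuallyEq hev'
    have huniq := hd.unique hx.2
    rw [hxg, zpow_sub_one₀ hx0, smul_eq_mul] at huniq
    have hp : (x - e) ^ n ≠ 0 := zpow_ne_zero n hx0
    field_simp at huniq
    linear_combination huniq
  have hsub : ContinuousAt (fun x : ℝ => x - e) e := by fun_prop
  have hl : Tendsto (fun x => (n : ℝ) * g x + (x - e) * deriv g x) (𝓝[≠] e)
      (𝓝 ((n : ℝ) * g e + (e - e) * deriv g e)) :=
    (((continuousAt_const.mul hg.continuousAt).add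
      (hsub.mul hg.deriv.continuousAt)).tendsto).mono_left nhdsWithin_le_nhds
  have hrr : Tendsto (fun x => (a + (x - e) * valueAt r x) * g x) (𝓝[≠] e)
      (𝓝 ((a + (e - e) * valueAt r e) * g e)) :=
    (((continuousAt_const.add (hsub.mul (hasDerivAt_valueAt hr).continuousAt)).mul
      hg.continuousAt).tendsto).mono_left nhdsWithin_le_nhds
  have heq := tendsto_nhds_unique (hl.congr' key) hrr
  rw [sub_self, zero_mul, zero_mul, add_zero, add_zero] at heq
  exact ⟨n, mul_right_cancel₀ hg0 heq⟩

/-- A meromorphic function on an interval whose derivative vanishes off a finite set is constant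
off that set. -/
theorem eq_const_of_deriv_eq_zero {g : ℝ → ℝ} {J S : Set ℝ} (hJo : IsOpen J)
    (hJ : IsPreconnected J) (hJn : J.Nonempty) (hg : MeromorphicOn g J) (hS : S.Finite)
    (h : ∀ x ∈ J \ S, HasDerivAt g 0 x) : ∃ c, ∀ x ∈ J \ S, g x = c := by
  obtain ⟨x₁, hx₁⟩ := ((infinite_of_isOpen hJo hJn).sdiff hS).nonempty
  have hopen : IsOpen (J \ S) := hJo.sdiff hS.isClosed
  have hm : MeromorphicOn (fun x => g x - g x₁) J := fun x hx =>
    (hg x hx).sub (MeromorphicAt.const _ _)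
  have hloc : ∀ᶠ x in 𝓝 x₁, g x - g x₁ = 0 := by
    obtain ⟨ε, hε, hball⟩ := Metric.isOpen_iff.1 hopen x₁ hx₁
    filter_upwards [Metric.ball_mem_nhds x₁ hε] with x hx
    refine sub_eq_zero.2 ((convex_ball x₁ ε).is_const_of_fderivWithin_eq_zero (𝕜 := ℝ)
      (fun y hy => (h y (hball hy)).differentiableAt.differentiableWithinAt) (fun y hy => ?_) hx
      (Metric.mem_ball_self hε))
    rw [fderivWithin_of_isOpen Metric.isOpen_ball hy]
    ext
    simp [(h y (hball hy)).deriv]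
  have htop : meromorphicOrderAt (fun x => g x - g x₁) x₁ = ⊤ :=
    meromorphicOrderAt_eq_top_iff.2 (hloc.filter_mono nhdsWithin_le_nhds)
  -- The complement of S in J may be disconnected. Infinite vanishing order propagates through the
  -- preconnected J itself, across the points of S.
  have hall : ∀ x : J, meromorphicOrderAt (fun x => g x - g x₁) x = ⊤ := by
    by_contra hc
    push Not at hc
    have := (hm.exists_meromorphicOrderAt_ne_top_iff_forall ⟨hJn, hJ⟩).1 hc ⟨x₁, hx₁.1⟩
    exact this htop
  refine ⟨g x₁, fun x hx => ?_⟩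
  have hev := meromorphicOrderAt_eq_top_iff.1 (hall ⟨x, hx.1⟩)
  have ht : Tendsto g (𝓝[≠] x) (𝓝 (g x)) :=
    (h x hx).continuousAt.tendsto.mono_left nhdsWithin_le_nhds
  refine tendsto_nhds_unique ht (tendsto_const_nhds.congr' ?_)
  filter_upwards [hev] with y hy
  exact (sub_eq_zero.1 hy).symm

/-- Two quasi-rational functions with the same logarithmic derivative are proportional. -/
theorem IsQuasiRationalOn.exists_eq_mul {φ ψ : ℝ → ℝ} {J : Set ℝ} (hJo : IsOpen J)
    (hJ : IsPreconnected J) (hJn : J.Nonempty) {w : RatFunc ℝ} (hφ : IsQuasiRationalOn φ J w)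
    (hψ : IsQuasiRationalOn ψ J w) :
    ∃ c : ℝ, c ≠ 0 ∧ ∃ S : Set ℝ, S.Finite ∧ ∀ x ∈ J \ S, φ x = c * ψ x := by
  obtain ⟨mφ, S, hS, hφ⟩ := hφ
  obtain ⟨mψ, S', hS', hψ⟩ := hψ
  obtain ⟨c, hc⟩ := eq_const_of_deriv_eq_zero hJo hJ hJn
    (g := fun x => φ x / ψ x) (fun x hx => (mφ x hx).div (mψ x hx)) (hS.union hS') (by
      rintro x ⟨hxJ, hx⟩
      rw [Set.mem_union, not_or] at hx
      have h1 := hφ x ⟨hxJ, hx.1⟩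
      have h2 := hψ x ⟨hxJ, hx.2⟩
      refine (h1.2.div h2.2 h2.1).congr_deriv ?_
      ring)
  have hmul : ∀ x ∈ J \ (S ∪ S'), φ x = c * ψ x := by
    rintro x ⟨hxJ, hx⟩
    have h2 := hψ x ⟨hxJ, fun h => hx (Or.inr h)⟩
    exact (div_eq_iff h2.1).1 (hc x ⟨hxJ, hx⟩)
  refine ⟨c, ?_, _, hS.union hS', hmul⟩
  rintro rfl
  obtain ⟨x, hx⟩ := ((infinite_of_isOpen hJo hJn).sdiff (hS.union hS')).nonempty
  exact (hφ x ⟨hx.1, fun h => hx.2 (Or.inl h)⟩).1 (by rw [hmul x hx, zero_mul])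

/-! ### The shape of the eigenfunctions -/

theorem isQuasiRationalOn_jacobiWeight (a b : ℝ) :
    IsQuasiRationalOn (jacobiWeight a b) (Set.Ioo (-1) 1) (muLogDeriv a b) := by
  refine ⟨fun x hx => meromorphicAt_jacobiWeight (fun h => absurd h hx.2.ne)
    (fun h => absurd h hx.1.ne'), ∅, Set.finite_empty, fun x hx => ?_⟩
  have h1 := hx.1.2.ne
  have h2 := hx.1.1.ne'
  exact ⟨jacobiWeight_ne_zero h1 h2, hasDerivAt_jacobiWeight h1 h2⟩

theorem meromorphicAt_eval (P : ℝ[X]) (x : ℝ) : MeromorphicAt (fun y => P.eval y) x :=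
  (AnalyticOnNhd.eval_polynomial P x trivial).meromorphicAt

/-- Integrality is required only at an endpoint inside J, where a branch with non-integer exponent
need not be meromorphic. -/
theorem isQuasiRationalOn_form {a b : ℝ} {σ τ : ℝ[X]} (hσ : σ ≠ 0) (hτ : τ ≠ 0) {J : Set ℝ}
    (h1 : 1 ∈ J → a ∈ Set.range (Int.cast : ℤ → ℝ))
    (h2 : -1 ∈ J → b ∈ Set.range (Int.cast : ℤ → ℝ)) :
    IsQuasiRationalOn (fun x => jacobiWeight a b x * (σ.eval x / τ.eval x)) J
      (muLogDeriv a b + logD σ - logD τ) := by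
  refine ⟨fun x hx => (meromorphicAt_jacobiWeight (fun h => h1 (h ▸ hx)) (fun h => h2 (h ▸ hx))).mul
    ((meromorphicAt_eval σ x).div (meromorphicAt_eval τ x)),
    {1, -1} ∪ ({x | σ.eval x = 0} ∪ {x | τ.eval x = 0}), (Set.toFinite _).union
      ((finite_eval_eq_zero hσ).union (finite_eval_eq_zero hτ)), ?_⟩
  rintro x ⟨-, hx⟩
  simp only [Set.mem_union, Set.mem_insert_iff, Set.mem_singleton_iff, Set.mem_ofPred_eq,
    not_or] at hx
  obtain ⟨⟨hx1, hx2⟩, hxσ, hxτ⟩ := hx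
  refine ⟨mul_ne_zero (jacobiWeight_ne_zero hx1 hx2) (div_ne_zero hxσ hxτ), ?_⟩
  refine ((hasDerivAt_jacobiWeight hx1 hx2).mul
    ((σ.hasDerivAt x).div (τ.hasDerivAt x) hxτ)).congr_deriv ?_
  rw [valueAt_sub ((regularAt_muLogDeriv hx1 hx2).add (regularAt_logD hxσ)) (regularAt_logD hxτ),
    valueAt_add (regularAt_muLogDeriv hx1 hx2) (regularAt_logD hxσ), valueAt_logD hxσ,
    valueAt_logD hxτ, Pi.div_apply]
  field_simp
  ring

theorem exponent_mem_range_intCast {φ : ℝ → ℝ} {J : Set ℝ} (hJo : IsOpen J) {w r : RatFunc ℝ}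
    {e a : ℝ} (he : e ∈ J) (hφ : IsQuasiRationalOn φ J w) (hr : RegularAt r e)
    (hw : w = RatFunc.C (-a) / ofPoly (X - C e) + r) : a ∈ Set.range (Int.cast : ℤ → ℝ) := by
  obtain ⟨mφ, S, hS, hd⟩ := hφ
  obtain ⟨n, hn⟩ : -a ∈ Set.range (Int.cast : ℤ → ℝ) := by
    refine residue_mem_range_intCast (mφ e he) hr ?_
    have hfin : ∀ᶠ x in 𝓝[≠] e, x ∉ S ∪ {x | ¬ RegularAt r x} :=
      nhdsNE_le_cofinite e (hS.union (finite_not_regularAt r)).compl_mem_cofinite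
    have hJe : ∀ᶠ x in 𝓝[≠] e, x ∈ J := nhdsWithin_le_nhds (hJo.mem_nhds he)
    filter_upwards [hfin, hJe, self_mem_nhdsWithin] with x hx hxJ hxe
    simp only [Set.mem_union, Set.mem_ofPred_eq, not_or, not_not] at hx
    have hval : valueAt w x = -a / (x - e) + valueAt r x := by
      rw [hw, ← RatFunc.algebraMap_C, valueAt_add (regularAt_div (eval_X_sub_C_ne_zero hxe)) hx.2,
        valueAt_div (eval_X_sub_C_ne_zero hxe)]
      simp
    rw [← hval]
    exact hd x ⟨hxJ, hx.1⟩
  exact ⟨-n, by push_cast; linarith⟩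

end XJacobi

end

/-! ### Assembly of the main theorem -/

theorem mainTheorem7 (τ : Polynomial ℝ) (α β : ℝ)
    (hτ1 : τ.eval 1 ≠ 0) (hτ2 : τ.eval (-1) ≠ 0)
    (hT : (XJacobi.Tng τ α β).IsExceptionalJacobi)
    (J : Set ℝ) (hJo : IsOpen J) (hJc : IsPreconnected J) (hJn : J.Nonempty)
    (φ : ℝ → ℝ) (w : RatFunc ℝ) (κ : ℝ)
    (hφ : (XJacobi.Trg τ α β).IsQREigenfunctionOn κ φ J w) :
    ∃ τhat : Polynomial ℝ,
      τhat.eval 1 ≠ 0 ∧ τhat.eval (-1) ≠ 0 ∧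
      (∃ S : Set ℝ, S.Finite ∧ ∀ x ∈ J \ S,
        φ x = XJacobi.mu α β (XJacobi.asympType w) x * (τhat.eval x / τ.eval x)) ∧
      κ = XJacobi.qrDegree w * (XJacobi.qrDegree w + α + β + 1) ∧
      ∃ wμ : RatFunc ℝ,
        XJacobi.IsQuasiRationalOn (XJacobi.mu α β (XJacobi.asympType w))
          (Set.Ioo (-1) 1) wμ ∧
        XJacobi.qrDegree wμ = XJacobi.muDegree α β (XJacobi.asympType w) ∧
        XJacobi.qrDegree w
          = XJacobi.qrDegree wμ + (τhat.natDegree : ℝ) - (τ.natDegree : ℝ) := by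
  have hτ : τ ≠ 0 := by rintro rfl; simp at hτ1
  -- A cofinite set of degrees is nonempty, and one eigenpolynomial is all the argument needs.
  obtain ⟨n, P, hP, -, κ₀, hPκ⟩ : (XJacobi.Tng τ α β).degreeSet.Nonempty := by
    rw [Set.nonempty_iff_ne_empty]
    intro h0
    have := hT.2
    rw [h0, Set.compl_empty] at this
    exact Set.infinite_univ this
  have h₀ := XJacobi.isRiccatiSolution_of_eigen hτ hP hPκ
  have h := (XJacobi.isRiccatiSolution_iff hτ).2
    (XJacobi.riccati_of_eigenfunction hJo hJn hφ)
  rw [XJacobi.mu_asympType, XJacobi.muDegree_asympType]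
  obtain ⟨a, ha⟩ : ∃ a, a = if w.denom.eval 1 = 0 then α else 0 := ⟨_, rfl⟩
  obtain ⟨b, hb⟩ : ∃ b, b = if w.denom.eval (-1) = 0 then β else 0 := ⟨_, rfl⟩
  rw [← ha, ← hb]
  obtain ⟨σ, hσ1, hσ2, hw, hκ, hdeg⟩ := XJacobi.exists_form hτ1 hτ2 hP h₀ h ha hb
  have hσ : σ ≠ 0 := by rintro rfl; simp at hσ1
  -- The remaining part r of w is regular at 1, so a is, up to sign, the residue of w there; if w
  -- has no pole at 1, this a is 0.
  have hint1 : 1 ∈ J → a ∈ Set.range (Int.cast : ℤ → ℝ) := fun h1 => by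
    refine XJacobi.exponent_mem_range_intCast hJo h1 hφ.1 (r := XJacobi.ofPoly (Polynomial.C (-b)) /
      XJacobi.ofPoly (Polynomial.X - Polynomial.C (-1)) + XJacobi.logD σ - XJacobi.logD τ)
      (((XJacobi.regularAt_div (XJacobi.eval_X_sub_C_ne_zero (by norm_num))).add
        (XJacobi.regularAt_logD hσ1)).sub (XJacobi.regularAt_logD hτ1)) ?_
    rw [hw, XJacobi.muLogDeriv, RatFunc.algebraMap_C]
    ring
  have hint2 : -1 ∈ J → b ∈ Set.range (Int.cast : ℤ → ℝ) := fun h1 => by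
    refine XJacobi.exponent_mem_range_intCast hJo h1 hφ.1 (r := XJacobi.ofPoly (Polynomial.C (-a)) /
      XJacobi.ofPoly (Polynomial.X - Polynomial.C 1) + XJacobi.logD σ - XJacobi.logD τ)
      (((XJacobi.regularAt_div (XJacobi.eval_X_sub_C_ne_zero (by norm_num))).add
        (XJacobi.regularAt_logD hσ2)).sub (XJacobi.regularAt_logD hτ2)) ?_
    rw [hw, XJacobi.muLogDeriv, RatFunc.algebraMap_C]
    ring
  have hψ := XJacobi.isQuasiRationalOn_form hσ hτ hint1 hint2
  rw [← hw] at hψ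
  obtain ⟨c, hc, S, hS, hφψ⟩ := hφ.1.exists_eq_mul hJo hJc hJn hψ
  have hmu : XJacobi.qrDegree (XJacobi.muLogDeriv a b) = -a - b := by
    rw [XJacobi.qrDegree_eq (XJacobi.hasValueInfty_muLogDeriv a b), sub_eq_add_neg]
  -- The nonzero proportionality constant is absorbed into σ without changing its degree.
  refine ⟨Polynomial.C c * σ, ?_, ?_, ⟨S, hS, fun x hx => ?_⟩, hκ, XJacobi.muLogDeriv a b,
    XJacobi.isQuasiRationalOn_jacobiWeight a b, hmu, ?_⟩
  · rw [Polynomial.eval_mul, Polynomial.eval_C]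
    exact mul_ne_zero hc hσ1
  · rw [Polynomial.eval_mul, Polynomial.eval_C]
    exact mul_ne_zero hc hσ2
  · rw [hφψ x hx, Polynomial.eval_mul, Polynomial.eval_C]
    ring
  · rw [hmu, Polynomial.natDegree_C_mul hc, hdeg]
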